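/- Let $a<b$, $\Omega=(a,b)$, $L=b-a$, $K(\rho)=\rho/(1+\rho)$ for $\rho\ge 0$, and $g(x)=x$. For $u\in BV(\Omega)$ (that is, $u\in L^1(\Omega)$ whose distributional derivative $Du$ is a finite signed measure on $\Omega$) and $\lambda>0$ put $$TV_{Kg}(u)=|Du|(\Omega\setminus J_u)+\sum_{x\in J_u}K\bigl(|u(x+0)-u(x-0)|\bigr)+\frac{\lambda}{2}\int_\Omega|u(x)-g(x)|^2\,dx ,$$ where $|Du|$ is the total variation measure of $Du$, $u(x\pm0)$ are the one-sided (approximate) traces of $u$, and $J_u\subset\Omega$ is the jump set, i.e. the set of points at which both traces exist and differ. Then minimizers of $TV_{Kg}$ are in general not unique: (i) There is a $\lambda>0$ such that $TV_{Kg}$ has at least two minimizers in $BV(\Omega)$: a non-decreasing piecewise constant function with exactly one jump, and a non-decreasing piecewise constant function with exactly two jumps. (ii) For the explicit value $$\lambda=\frac{32}{L(L+1)(L+2)},$$ $TV_{Kg}$ has at least two minimizers among the functions $u\in BV(\Omega)$ with boundary values $u(a+0)=g(a)$ and $u(b-0)=g(b)$: a non-decreasing piecewise constant function with exactly one jump,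 and a non-decreasing piecewise constant function with exactly two jumps. -/

import Mathlib

open MeasureTheory Set Filter Topology
open scoped ENNReal ContDiff

noncomputable section

namespace KWC

/-- The signed measure `μ` is the distributional derivative of `u` on the open interval `(a, b)`:
`∫ u φ' dx = - ∫ φ dμ` for all smooth `φ` with compact support in `(a, b)`.
(The integral against `μ` is written through the Jordan decomposition `μ = μ⁺ - μ⁻`; only the
restriction of `μ` to `(a, b)` matters, and it is determined by `u`.) -/
def HasDistribDeriv (a b : ℝ) (u : ℝ → ℝ) (μ : SignedMeasure ℝ) : Prop :=
  ∀ φ : ℝ → ℝ, ContDiff ℝ ∞ φ → HasCompactSupport φ → tsupport φ ⊆ Ioo a b →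
    ∫ x in Ioo a b, u x * deriv φ x =
      -((∫ x, φ x ∂μ.toJordanDecomposition.posPart) -
        ∫ x, φ x ∂μ.toJordanDecomposition.negPart)

/-- `u ∈ BV(a, b)`: `u` is integrable on `(a, b)` and its distributional derivative there is a
finite signed measure. Values of `u` outside `(a, b)` are irrelevant. -/
def IsBV (a b : ℝ) (u : ℝ → ℝ) : Prop :=
  IntegrableOn u (Ioo a b) ∧ ∃ μ : SignedMeasure ℝ, HasDistribDeriv a b u μ

open Classical in
/-- The distributional derivative `Du` of `u` on `(a, b)`. -/
def distribDeriv (a b : ℝ) (u : ℝ → ℝ) : SignedMeasure ℝ :=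
  if h : ∃ μ : SignedMeasure ℝ, HasDistribDeriv a b u μ then h.choose else 0

/-- `p` is the (approximate) trace `u(x + 0)` of `u` at `x` from the right. -/
def HasRightTrace (u : ℝ → ℝ) (x p : ℝ) : Prop :=
  Tendsto (fun r : ℝ => ⨍ y in Ioo x (x + r), |u y - p|) (𝓝[>] 0) (𝓝 0)

/-- `p` is the (approximate) trace `u(x - 0)` of `u` at `x` from the left. -/
def HasLeftTrace (u : ℝ → ℝ) (x p : ℝ) : Prop :=
  Tendsto (fun r : ℝ => ⨍ y in Ioo (x - r) x, |u y - p|) (𝓝[>] 0) (𝓝 0)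

/-- The trace from the right (it is unique when it exists). -/
def rightTrace (u : ℝ → ℝ) (x : ℝ) : ℝ := Classical.epsilon (HasRightTrace u x)

/-- The trace from the left (it is unique when it exists). -/
def leftTrace (u : ℝ → ℝ) (x : ℝ) : ℝ := Classical.epsilon (HasLeftTrace u x)

/-- The approximate jump set `J_u` of `u` in `(a, b)`. -/
def jumpSet (a b : ℝ) (u : ℝ → ℝ) : Set ℝ :=
  {x | x ∈ Ioo a b ∧ ∃ p q : ℝ, p ≠ q ∧ HasLeftTrace u x p ∧ HasRightTrace u x q}

/-- `TV_K(u) = ∫_{Ω \ J_u} |Du| + ∫_{J_u} K(|u⁺ - u⁻|) dℋ⁰` for `Ω = (a, b)`; here `ℋ⁰` is the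
counting measure. -/
def TV (K : ℝ → ℝ) (a b : ℝ) (u : ℝ → ℝ) : ℝ≥0∞ :=
  (distribDeriv a b u).totalVariation (Ioo a b \ jumpSet a b u) +
    ∑' x : jumpSet a b u, ENNReal.ofReal (K |rightTrace u x - leftTrace u x|)

/-- The fidelity term `(lam / 2) ∫_Ω |u - g|² dx` for `Ω = (a, b)`. -/
def fidelity (g : ℝ → ℝ) (lam a b : ℝ) (u : ℝ → ℝ) : ℝ≥0∞ :=
  ENNReal.ofReal (lam / 2) * ∫⁻ x in Ioo a b, ENNReal.ofReal (|u x - g x| ^ 2)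

/-- The energy `TV_{Kg}(u) = TV_K(u) + (lam / 2) ∫_Ω |u - g|² dx`. -/
def energy (K g : ℝ → ℝ) (lam a b : ℝ) (u : ℝ → ℝ) : ℝ≥0∞ :=
  TV K a b u + fidelity g lam a b u

/-- `U` minimizes `TV_{Kg}` over `BV(a, b)`. -/
def IsMinimizer (K g : ℝ → ℝ) (lam a b : ℝ) (U : ℝ → ℝ) : Prop :=
  IsBV a b U ∧ ∀ v : ℝ → ℝ, IsBV a b v → energy K g lam a b U ≤ energy K g lam a b v

/-- `u` has the boundary values of `g`: `u(a + 0) = g(a)` and `u(b - 0) = g(b)`. -/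
def HasBoundaryValues (g : ℝ → ℝ) (a b : ℝ) (u : ℝ → ℝ) : Prop :=
  HasRightTrace u a (g a) ∧ HasLeftTrace u b (g b)

/-- `U` minimizes `TV_{Kg}` among the functions in `BV(a, b)` with the boundary values of `g`. -/
def IsDirichletMinimizer (K g : ℝ → ℝ) (lam a b : ℝ) (U : ℝ → ℝ) : Prop :=
  (IsBV a b U ∧ HasBoundaryValues g a b U) ∧
    ∀ v : ℝ → ℝ, IsBV a b v → HasBoundaryValues g a b v →
      energy K g lam a b U ≤ energy K g lam a b v

/-- `u` is a non-decreasing piecewise constant function on `(a, b)` with exactly `m` jumps: there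
are jump points `a < t 0 < ⋯ < t (m - 1) < b` and values `c 0 < ⋯ < c m` such that `u = c j` on the
`j`-th of the `m + 1` open intervals into which the jump points cut `(a, b)`. -/
def IsIncreasingStep (a b : ℝ) (m : ℕ) (u : ℝ → ℝ) : Prop :=
  ∃ (t : Fin m → ℝ) (c : Fin (m + 1) → ℝ), StrictMono t ∧ StrictMono c ∧
    (∀ i, t i ∈ Ioo a b) ∧
    ∀ (j : Fin (m + 1)) (x : ℝ), x ∈ Ioo a b →
      (∀ i : Fin m, i.castSucc < j → t i < x) → (∀ i : Fin m, j ≤ i.castSucc → x < t i) →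
      u x = c j

end KWC

end

/-! The variational problem reduces to choosing finitely many jump heights. Covering a height `r` by
one jump costs at least f(r) = `stepCost lam r`: the jump term K(r), plus the fidelity of the two
values against g, which is least (`lam * r ^ 3 / 24`) when the jump sits where g is midway between
them. Height left uncovered at the two ends, P in total of the jumps and L - P of the rest, costs at
least `lam * (L - P) ^ 3 / 24`.

Lower bound for arbitrary u in BV. Sample u at one good point in each cell of a uniform grid. The
cost K of an increment is at most the TV_K of u over the corresponding interval, since K is
increasing and K(ρ)/ρ decreasing (`jumpCost_le_costMeasure`). Clipping the samples to [a, b] and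
sorting them raises neither the jump cost nor the fidelity, because g is increasing
(`pathCost_insertionSort_le`, and the rearrangement inequality in `sum_sq_sort_le`). Summation by
parts turns the sorted path into heights ρ i with energy at least the sum of f(ρ i) plus end terms,
up to an error of the order of the mesh (`discrete_energy_ge`). Let the mesh tend to zero.

The finite problem. The cost per unit height f(r)/r decreases up to a point r₀ and then increases.
For total height P ≤ 2r₀ the cheapest family is one jump or two equal jumps (`min_le_sum_stepCost`).
For P ≥ 2r₀ a convexity argument shows that no family is better once one and two jumps tie
(`le_sum_stepCost_of_tie`).

The tie. With boundary values P = L, and the explicit `lam` solves f(L) = 2f(L/2). Without them, the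
optimal energies of one and of two jumps are continuous in `lam` and change order, so they agree
somewhere (`exists_tie`). Explicit step functions attain the bounds. -/

namespace KWC

/-! ### The cost of finite families of jump heights -/

/-- The least energy spent on a jump of height `r`: the jump cost plus the fidelity `lam * r ^ 3 / 24`
of a jump placed at its best position. -/
noncomputable def stepCost (lam r : ℝ) : ℝ := r / (1 + r) + lam * r ^ 3 / 24

/-- The cost of a jump of height `r` per unit of height. -/
noncomputable def unitCost (lam r : ℝ) : ℝ := 1 / (1 + r) + lam * r ^ 2 / 24

theorem stepCost_eq (lam r : ℝ) : stepCost lam r = r * unitCost lam r := by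
  unfold stepCost unitCost; ring

theorem stepCost_zero (lam : ℝ) : stepCost lam 0 = 0 := by simp [stepCost]

/-- In factored form the sign is decided by comparing `lam * (x + y) * ((1 + x) * (1 + y))` with 24.
This product increases in both arguments and equals 24 at x = y = r₀ when `lam * r₀ * (1 + r₀) ^ 2 =
12`, which is the vanishing of the derivative of `unitCost lam` at r₀. -/
theorem unitCost_sub {lam x y : ℝ} (hx : 0 ≤ x) (hy : 0 ≤ y) :
    unitCost lam y - unitCost lam x =
      (y - x) / (24 * ((1 + x) * (1 + y))) * (lam * (x + y) * ((1 + x) * (1 + y)) - 24) := by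
  unfold unitCost
  field_simp
  ring

theorem unitCost_anti {lam r₀ x y : ℝ} (hlam : 0 < lam) (hr₀ : lam * r₀ * (1 + r₀) ^ 2 = 12)
    (hx : 0 ≤ x) (hxy : x ≤ y) (hy : y ≤ r₀) : unitCost lam y ≤ unitCost lam x := by
  rw [← sub_nonpos, unitCost_sub hx (hx.trans hxy)]
  have h0 : 0 ≤ y := hx.trans hxy
  refine mul_nonpos_of_nonneg_of_nonpos (by have := sub_nonneg.2 hxy; positivity) ?_
  have h1 : lam * (x + y) * ((1 + x) * (1 + y)) ≤ lam * (r₀ + r₀) * ((1 + r₀) * (1 + r₀)) := by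
    have : 0 ≤ r₀ := h0.trans hy
    gcongr <;> linarith
  nlinarith

theorem unitCost_strictMono {lam r₀ x y : ℝ} (hlam : 0 < lam) (h0 : 0 < r₀)
    (hr₀ : lam * r₀ * (1 + r₀) ^ 2 = 12) (hx : r₀ ≤ x) (hxy : x < y) :
    unitCost lam x < unitCost lam y := by
  have hx0 : 0 < x := h0.trans_le hx
  have hy0 : 0 < y := hx0.trans hxy
  rw [← sub_pos, unitCost_sub hx0.le hy0.le]
  refine mul_pos (by have := sub_pos.2 hxy; positivity) ?_
  have h1 : lam * (r₀ + r₀) * ((1 + r₀) * (1 + r₀)) < lam * (x + y) * ((1 + x) * (1 + y)) := by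
    have h2 : r₀ + r₀ < x + y := by linarith
    have h3 : (1 + r₀) * (1 + r₀) ≤ (1 + x) * (1 + y) := by gcongr; linarith
    have h4 : lam * (r₀ + r₀) < lam * (x + y) := by gcongr
    exact mul_lt_mul h4 h3 (by positivity) (by positivity)
  nlinarith

theorem unitCost_min {lam r₀ x : ℝ} (hlam : 0 < lam) (h0 : 0 < r₀)
    (hr₀ : lam * r₀ * (1 + r₀) ^ 2 = 12) (hx : 0 ≤ x) : unitCost lam r₀ ≤ unitCost lam x := by
  rcases lt_or_ge r₀ x with h | h
  · exact (unitCost_strictMono hlam h0 hr₀ le_rfl h).le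
  · exact unitCost_anti hlam hr₀ hx h le_rfl

theorem exists_unitCost_critical {lam : ℝ} (hlam : 0 < lam) :
    ∃ r₀ : ℝ, 0 < r₀ ∧ lam * r₀ * (1 + r₀) ^ 2 = 12 := by
  have hc : ContinuousOn (fun r : ℝ => lam * r * (1 + r) ^ 2) (Icc 0 (12 / lam)) := by fun_prop
  have hpos : 0 < 12 / lam := by positivity
  have h := intermediate_value_Icc hpos.le hc
  have hm : (12 : ℝ) ∈ Icc (lam * 0 * (1 + 0) ^ 2) (lam * (12 / lam) * (1 + 12 / lam) ^ 2) := by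
    constructor
    · simp
    · rw [mul_div_cancel₀ _ hlam.ne']
      nlinarith
  obtain ⟨r, hr, hr'⟩ := h hm
  refine ⟨r, lt_of_le_of_ne hr.1 ?_, hr'⟩
  rintro rfl
  simp at hr'

/-- For fixed sum s the total cost depends only on the product z = xy, and it is concave in z: the
jump part is 2 - (2 + s)/(1 + s + z), the fidelity part is affine. Hence its minimum over 0 ≤ z ≤
s²/4 is at an endpoint, that is, at one jump or two equal jumps. The differences `e2` and `e3` are
the chord slopes to the two endpoints. -/
theorem stepCost_add_ge {lam x y : ℝ} (hx : 0 ≤ x) (hy : 0 ≤ y) :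
    min (stepCost lam (x + y)) (2 * stepCost lam ((x + y) / 2)) ≤
      stepCost lam x + stepCost lam y := by
  obtain ⟨s, hs⟩ : ∃ s, s = x + y := ⟨_, rfl⟩
  obtain ⟨z, hz⟩ : ∃ z, z = x * y := ⟨_, rfl⟩
  have hs0 : 0 ≤ s := by rw [hs]; positivity
  have hz0 : 0 ≤ z := by rw [hz]; positivity
  have hzs : z ≤ s ^ 2 / 4 := by rw [hs, hz]; nlinarith [sq_nonneg (x - y)]
  have e1 : stepCost lam x + stepCost lam y =
      (s + 2 * z) / (1 + s + z) + lam / 24 * (s ^ 3 - 3 * s * z) := by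
    have h1 : 1 + s + z = (1 + x) * (1 + y) := by rw [hs, hz]; ring
    rw [h1, hs, hz]
    unfold stepCost
    field_simp
    ring
  have e2 : stepCost lam x + stepCost lam y - stepCost lam s =
      z * ((2 + s) / ((1 + s) * (1 + s + z)) - lam * s / 8) := by
    rw [e1]
    unfold stepCost
    field_simp
    ring
  have e3 : 2 * stepCost lam (s / 2) - (stepCost lam x + stepCost lam y) =
      (s ^ 2 / 4 - z) * ((2 + s) / ((1 + s + z) * (1 + s + s ^ 2 / 4)) - lam * s / 8) := by
    rw [e1]
    have h1 : 1 + s + s ^ 2 / 4 = (1 + s / 2) ^ 2 := by ring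
    rw [h1]
    unfold stepCost
    field_simp
    ring
  rw [← hs]
  rcases le_total (lam * s / 8) ((2 + s) / ((1 + s) * (1 + s + z))) with h | h
  · refine min_le_of_left_le ?_
    have := mul_nonneg hz0 (sub_nonneg.2 h)
    linarith
  · refine min_le_of_right_le ?_
    have h2 : (2 + s) / ((1 + s + z) * (1 + s + s ^ 2 / 4)) ≤
        (2 + s) / ((1 + s) * (1 + s + z)) := by
      rw [mul_comm (1 + s) (1 + s + z)]
      refine div_le_div_of_nonneg_left (by positivity) (by positivity) ?_
      exact mul_le_mul_of_nonneg_left (by nlinarith) (by positivity)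
    have := mul_nonpos_of_nonneg_of_nonpos (sub_nonneg.2 hzs) (sub_nonpos.2 (h2.trans h))
    linarith

theorem mul_unitCost_le_sum_stepCost {ι : Type*} {lam c : ℝ} (s : Finset ι) (ρ : ι → ℝ)
    (hρ : ∀ i ∈ s, 0 ≤ ρ i) (hc : ∀ i ∈ s, c ≤ unitCost lam (ρ i)) :
    (∑ i ∈ s, ρ i) * c ≤ ∑ i ∈ s, stepCost lam (ρ i) := by
  rw [Finset.sum_mul]
  refine Finset.sum_le_sum fun i hi => ?_
  rw [stepCost_eq]
  exact mul_le_mul_of_nonneg_left (hc i hi) (hρ i hi)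

/-- Below r₀ the unit cost decreases, so merging is favourable. If every height is at most P/2 ≤ r₀,
each has unit cost at least that of P/2. Otherwise one height exceeds P/2, the others together stay
below r₀ and may be merged into one, and the two-height case applies. -/
theorem min_le_sum_stepCost {ι : Type*} {lam r₀ : ℝ} (hlam : 0 < lam)
    (hr₀ : lam * r₀ * (1 + r₀) ^ 2 = 12) (s : Finset ι) (ρ : ι → ℝ) (hρ : ∀ i ∈ s, 0 ≤ ρ i)
    (hP : ∑ i ∈ s, ρ i ≤ 2 * r₀) :
    min (stepCost lam (∑ i ∈ s, ρ i)) (2 * stepCost lam ((∑ i ∈ s, ρ i) / 2)) ≤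
      ∑ i ∈ s, stepCost lam (ρ i) := by
  classical
  by_cases h : ∀ i ∈ s, ρ i ≤ (∑ i ∈ s, ρ i) / 2
  · refine min_le_of_right_le ?_
    have h1 := mul_unitCost_le_sum_stepCost (lam := lam) s ρ hρ
      (c := unitCost lam ((∑ i ∈ s, ρ i) / 2))
      fun i hi => unitCost_anti hlam hr₀ (hρ i hi) (h i hi) (by linarith)
    rw [stepCost_eq]
    linarith
  · push Not at h
    obtain ⟨j, hj, hjP⟩ := h
    have e : ∑ i ∈ s, ρ i = ρ j + ∑ i ∈ s.erase j, ρ i := (Finset.add_sum_erase s ρ hj).symm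
    have e' : ∑ i ∈ s, stepCost lam (ρ i) =
        stepCost lam (ρ j) + ∑ i ∈ s.erase j, stepCost lam (ρ i) :=
      (Finset.add_sum_erase s (fun i => stepCost lam (ρ i)) hj).symm
    have hnn : ∀ i ∈ s.erase j, 0 ≤ ρ i := fun i hi => hρ i (Finset.mem_of_mem_erase hi)
    have h1 := mul_unitCost_le_sum_stepCost (lam := lam) (s.erase j) ρ hnn
      (c := unitCost lam (∑ i ∈ s.erase j, ρ i))
      fun i hi => unitCost_anti hlam hr₀ (hnn i hi)
        (Finset.single_le_sum (f := ρ) hnn hi) (by linarith)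
    rw [← stepCost_eq] at h1
    rw [e, e']
    exact (stepCost_add_ge (hρ j hj) (Finset.sum_nonneg hnn)).trans (by linarith)

/-! ### One jump against two jumps without boundary values -/

/-- Energy of the best monotone step with one jump of height `r`, without boundary values. -/
noncomputable def energyOne (L lam r : ℝ) : ℝ := stepCost lam r + lam * (L - r) ^ 3 / 24

/-- Energy of the best monotone step with two jumps of height `r`, without boundary values. -/
noncomputable def energyTwo (L lam r : ℝ) : ℝ := 2 * stepCost lam r + lam * (L - 2 * r) ^ 3 / 24

/-- Three-point form of the convexity of t ↦ (L - t)³ on t ≤ L. -/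
theorem cube_convex {x y z L : ℝ} (hxy : x ≤ y) (hyz : y ≤ z) (hz : z ≤ L) :
    (z - x) * (L - y) ^ 3 ≤ (z - y) * (L - x) ^ 3 + (y - x) * (L - z) ^ 3 := by
  have : (z - y) * (L - x) ^ 3 + (y - x) * (L - z) ^ 3 - (z - x) * (L - y) ^ 3 =
      (z - y) * (y - x) * (z - x) * ((L - x) + (L - y) + (L - z)) := by ring
  have h : 0 ≤ (z - y) * (y - x) * (z - x) * ((L - x) + (L - y) + (L - z)) := by
    refine mul_nonneg (mul_nonneg (mul_nonneg ?_ ?_) ?_) ?_ <;> linarith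
  linarith

/-- If one jump and two jumps are equally good, no other number of jumps is better. -/
theorem le_sum_stepCost_of_tie {ι : Type*} {L lam m r₁ : ℝ} (hlam : 0 < lam)
    (h₁ : ∀ r, 0 ≤ r → r ≤ L → m ≤ energyOne L lam r)
    (h₂ : ∀ r, 0 ≤ r → 2 * r ≤ L → m ≤ energyTwo L lam r)
    (hr₁ : 0 ≤ r₁) (hr₁L : r₁ ≤ L) (hm : energyOne L lam r₁ = m)
    (s : Finset ι) (ρ : ι → ℝ) (hρ : ∀ i ∈ s, 0 ≤ ρ i) (hP : ∑ i ∈ s, ρ i ≤ L) :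
    m ≤ ∑ i ∈ s, stepCost lam (ρ i) + lam * (L - ∑ i ∈ s, ρ i) ^ 3 / 24 := by
  obtain ⟨r₀, h0, hr₀⟩ := exists_unitCost_critical hlam
  have hP0 : 0 ≤ ∑ i ∈ s, ρ i := Finset.sum_nonneg hρ
  rcases le_total (∑ i ∈ s, ρ i) (2 * r₀) with h | h
  · have h3 := min_le_sum_stepCost hlam hr₀ s ρ hρ h
    rcases min_le_iff.1 h3 with h4 | h4
    · have := h₁ _ hP0 hP
      unfold energyOne at this
      linarith
    · have := h₂ ((∑ i ∈ s, ρ i) / 2) (by positivity) (by linarith)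
      unfold energyTwo at this
      rw [mul_div_cancel₀ _ (two_ne_zero)] at this
      linarith
  · have h3 := mul_unitCost_le_sum_stepCost (lam := lam) s ρ hρ (c := unitCost lam r₀)
      fun i hi => unitCost_min hlam h0 hr₀ (hρ i hi)
    -- Otherwise both r₁/2 and r₁ lie in the range where the unit cost increases, and halving r₁
    -- would give two jumps strictly cheaper than m.
    have hr₁0 : r₁ < 2 * r₀ := by
      by_contra! hcon
      have h5 := unitCost_strictMono hlam h0 hr₀ (x := r₁ / 2) (y := r₁) (by linarith)
        (by linarith)
      have h6 := h₂ (r₁ / 2) (by linarith) (by linarith)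
      have h7 := mul_lt_mul_of_pos_left h5 (by linarith : 0 < r₁)
      unfold energyTwo at h6
      unfold energyOne at hm
      rw [stepCost_eq] at h6 hm
      rw [mul_div_cancel₀ _ (two_ne_zero)] at h6
      linarith
    have h4 := h₂ r₀ h0.le (h.trans hP)
    have h5 := mul_le_mul_of_nonneg_left (unitCost_min hlam h0 hr₀ hr₁) hr₁
    unfold energyTwo at h4
    unfold energyOne at hm
    rw [stepCost_eq] at h4 hm
    set P := ∑ i ∈ s, ρ i
    have h6 := cube_convex hr₁0.le h hP
    set u := unitCost lam r₀
    -- The right side is convex in P. It is at most m at r₁ and at least m at 2r₀ > r₁, hence at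
    -- least m at every P ≥ 2r₀.
    have h7 : m ≤ P * u + lam * (L - P) ^ 3 / 24 := by
      have h8 : 0 ≤ (2 * r₀ - r₁) * (P * u + lam * (L - P) ^ 3 / 24 - m) := by
        have a1 : (P - 2 * r₀) * (r₁ * u + lam * (L - r₁) ^ 3 / 24) ≤ (P - 2 * r₀) * m :=
          mul_le_mul_of_nonneg_left (by linarith) (by linarith)
        have a2 : (P - r₁) * m ≤ (P - r₁) * (2 * (r₀ * u) + lam * (L - 2 * r₀) ^ 3 / 24) :=
          mul_le_mul_of_nonneg_left h4 (by linarith)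
        have a3 := mul_le_mul_of_nonneg_left h6 (by positivity : 0 ≤ lam / 24)
        linarith
      have h9 := nonneg_of_mul_nonneg_right h8 (by linarith)
      linarith
    linarith

/-- `lam * L ^ 3 / 24` is the value at r = 0, the energy without jumps; the last factor decides
whether a jump of height r pays. -/
theorem energyOne_sub {L lam r : ℝ} (hr : 0 ≤ r) :
    energyOne L lam r - lam * L ^ 3 / 24 = r * (1 / (1 + r) - lam * L * (L - r) / 8) := by
  unfold energyOne stepCost
  field_simp
  ring

theorem energyTwo_sub {L lam r : ℝ} (hr : 0 ≤ r) :
    energyTwo L lam r - lam * L ^ 3 / 24 = 2 * r * (1 / (1 + r) - lam * (L - r) ^ 2 / 8) := by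
  unfold energyTwo stepCost
  field_simp
  ring

theorem energyTwo_sub_energyOne {L lam r : ℝ} (hr : 0 ≤ r) :
    energyTwo L lam r - energyOne L lam (2 * r) =
      r ^ 2 / (4 * ((1 + r) * (1 + 2 * r))) *
        (8 - lam * r * ((1 + r) * (1 + 2 * r))) := by
  unfold energyTwo energyOne stepCost
  field_simp
  ring

theorem continuous_stepCost_abs : Continuous fun p : ℝ × ℝ => stepCost p.1 |p.2| := by
  unfold stepCost
  refine Continuous.add (Continuous.div (by fun_prop) (by fun_prop) fun p => ?_) (by fun_prop)
  positivity

/-- Minimising a jointly continuous function over a fixed compact interval gives a value continuous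
in `lam`. It is used with k = 1 and k = 2 jumps. -/
theorem exists_continuous_isLeast {L M : ℝ} (hM : 0 ≤ M) (k : ℝ) :
    ∃ E : ℝ → ℝ, Continuous E ∧ ∀ lam, IsLeast
      ((fun r => k * stepCost lam r + lam * (L - k * r) ^ 3 / 24) '' Icc 0 M) (E lam) := by
  -- The absolute value keeps the denominator 1 + |r| positive, so that f is continuous on the whole
  -- plane.
  let f : ℝ → ℝ → ℝ := fun lam r => k * stepCost lam |r| + lam * (L - k * r) ^ 3 / 24
  have hf : Continuous ↿f := by
    have := continuous_stepCost_abs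
    change Continuous fun p : ℝ × ℝ => k * stepCost p.1 |p.2| + p.1 * (L - k * p.2) ^ 3 / 24
    fun_prop
  refine ⟨fun lam => sInf (f lam '' Icc 0 M), isCompact_Icc.continuous_sInf hf, fun lam => ?_⟩
  have e : (fun r => k * stepCost lam r + lam * (L - k * r) ^ 3 / 24) '' Icc 0 M =
      f lam '' Icc 0 M := by
    refine image_congr fun r hr => ?_
    simp [f, abs_of_nonneg hr.1]
  rw [e]
  have hc : Continuous (f lam) := hf.comp (Continuous.prodMk_right lam)
  exact (isCompact_Icc.image hc).isLeast_sInf ((nonempty_Icc.2 hM).image _)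

/-- By `energyTwo_sub` two jumps fail to beat the jump-free energy once `lam * (1 + r) * (L - r) ^ 2
≤ 8`. The product (1 + r)(L - r)² decreases for (L - 2)/3 ≤ r ≤ L, and `hA1` says that p/2 is
already in this range, so only r = p/2 has to be checked. -/
theorem energyTwo_ge_of_critical {L p lam r : ℝ} (hL : 0 < L) (hp : p * (1 + 2 * L) = 2 * L ^ 2)
    (hp0 : 0 < p) (hlam : lam * (p * (1 + p) * (2 + p)) = 32) (hlam0 : 0 < lam) (hr : p / 2 ≤ r)
    (hrL : 2 * r ≤ L) : lam * L ^ 3 / 24 ≤ energyTwo L lam r := by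
  have hr0 : 0 < r := by linarith
  rw [← sub_nonneg, energyTwo_sub hr0.le]
  refine mul_nonneg (by positivity) (sub_nonneg.2 ?_)
  have h1 : (1 + r) * (L - r) ^ 2 ≤ (1 + p / 2) * (L - p / 2) ^ 2 := by
    obtain ⟨A, hA⟩ : ∃ A, A = L - p / 2 := ⟨_, rfl⟩
    obtain ⟨B, hB⟩ : ∃ B, B = L - r := ⟨_, rfl⟩
    have hB0 : 0 ≤ B := by linarith
    have hAB : B ≤ A := by linarith
    have hA1 : 3 * A ≤ 2 * (1 + L) := by
      have : (L - 2) * (1 + 2 * L) ≤ 3 * (p / 2) * (1 + 2 * L) := by nlinarith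
      have := le_of_mul_le_mul_right this (by positivity)
      linarith
    have e : (1 + p / 2) * (L - p / 2) ^ 2 - (1 + r) * (L - r) ^ 2 =
        (A - B) * ((1 + L) * (A + B) - (A ^ 2 + A * B + B ^ 2)) := by rw [hA, hB]; ring
    have h2 : 0 ≤ (1 + L) * (A + B) - (A ^ 2 + A * B + B ^ 2) := by
      nlinarith [mul_nonneg hB0 (sub_nonneg.2 hAB), mul_le_mul_of_nonneg_right hA1
        (by linarith : 0 ≤ A + B)]
    have := mul_nonneg (sub_nonneg.2 hAB) h2
    linarith
  have h3 : lam * ((1 + p / 2) * (L - p / 2) ^ 2) ≤ 8 := by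
    have h4 : (2 * L - p) ^ 2 ≤ 2 * (p * (1 + p)) := by nlinarith
    have h5 := mul_le_mul_of_nonneg_left h4 (by positivity : 0 ≤ lam * (2 + p) / 8)
    linarith
  have h6 := mul_le_mul_of_nonneg_left h1 hlam0.le
  rw [le_div_iff₀ (by positivity)]
  linarith

theorem exists_tie {L : ℝ} (hL : 0 < L) : ∃ lam : ℝ, 0 < lam ∧ ∃ r₁ r₂ : ℝ,
    0 < r₁ ∧ r₁ ≤ L ∧ 0 < r₂ ∧ 2 * r₂ ≤ L ∧ energyOne L lam r₁ = energyTwo L lam r₂ ∧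
    (∀ r, 0 ≤ r → r ≤ L → energyOne L lam r₁ ≤ energyOne L lam r) ∧
    ∀ r, 0 ≤ r → 2 * r ≤ L → energyTwo L lam r₂ ≤ energyTwo L lam r := by
  -- The choice of p serves two purposes: (2L - p)² = 2p + p² ≤ 2p(1 + p) makes two jumps of height
  -- at least p/2 no better than none at `lam = l`, and L(2L - p) = p + Lp > p(1 + p) makes one jump
  -- of height p/2 strictly better than none.
  obtain ⟨p, hp⟩ : ∃ p, p * (1 + 2 * L) = 2 * L ^ 2 :=
    ⟨2 * L ^ 2 / (1 + 2 * L), by field_simp⟩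
  have hp0 : 0 < p := pos_of_mul_pos_left (by rw [hp]; positivity) (by positivity)
  have hpL : p < L := by nlinarith
  -- At this l one jump of height p ties two of height p/2; by `energyTwo_sub_energyOne`, for r ≤
  -- p/2 one jump of height 2r is no worse than two of height r.
  obtain ⟨l, hl⟩ : ∃ l, l * (p * (1 + p) * (2 + p)) = 32 :=
    ⟨32 / (p * (1 + p) * (2 + p)), by field_simp⟩
  have hl0 : 0 < l := pos_of_mul_pos_left (by rw [hl]; norm_num) (by positivity)
  obtain ⟨E₁, hE₁c, hE₁⟩ := exists_continuous_isLeast (L := L) hL.le 1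
  obtain ⟨E₂, hE₂c, hE₂⟩ := exists_continuous_isLeast (L := L) (M := L / 2) (by positivity) 2
  simp only [one_mul] at hE₁
  have hE₁le : ∀ lam r, 0 ≤ r → r ≤ L → E₁ lam ≤ energyOne L lam r := fun lam r h0 h1 =>
    (hE₁ lam).2 ⟨r, ⟨h0, h1⟩, rfl⟩
  have hE₂le : ∀ lam r, 0 ≤ r → 2 * r ≤ L → E₂ lam ≤ energyTwo L lam r := fun lam r h0 h1 =>
    (hE₂ lam).2 ⟨r, ⟨h0, by linarith⟩, rfl⟩
  have hstart : E₁ l ≤ E₂ l := by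
    obtain ⟨r, hr, hr'⟩ := (hE₂ l).1
    rw [← hr']
    change E₁ l ≤ energyTwo L l r
    rcases le_total (p / 2) r with h | h
    · have h1 := energyTwo_ge_of_critical hL hp hp0 hl hl0 h (by linarith [hr.2])
      have h2 := hE₁le l 0 le_rfl hL.le
      simp only [energyOne, stepCost_zero, sub_zero, zero_add] at h2
      exact h2.trans h1
    · have h1 := hE₁le l (2 * r) (by linarith [hr.1]) (by linarith [hr.2])
      have h2 := energyTwo_sub_energyOne (L := L) (lam := l) hr.1
      have h3 : l * r * ((1 + r) * (1 + 2 * r)) ≤ 8 := by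
        have h4 : l * r * ((1 + r) * (1 + 2 * r)) ≤
            l * (p / 2) * ((1 + p / 2) * (1 + 2 * (p / 2))) := by
          have := hr.1
          gcongr
        nlinarith
      have hr0 := hr.1
      have h5 : 0 ≤ r ^ 2 / (4 * ((1 + r) * (1 + 2 * r))) *
        (8 - l * r * ((1 + r) * (1 + 2 * r))) := mul_nonneg (by positivity) (by linarith)
      linarith
  -- For large `lam` two jumps of height L/3 cost at most 2 + `lam * L ^ 3 / 216`, while any single
  -- jump costs at least `lam * L ^ 3 / 96`. The first is smaller once `lam * L ^ 3` exceeds 345.6,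
  -- so 400 suffices.
  obtain ⟨l', hl'⟩ : ∃ l', l' = l + 400 / L ^ 3 := ⟨_, rfl⟩
  have hll' : l ≤ l' := by rw [hl']; have : 0 < 400 / L ^ 3 := by positivity
                           linarith
  have hend : E₂ l' ≤ E₁ l' := by
    have hl'L : 400 ≤ l' * L ^ 3 := by
      rw [hl', add_mul, div_mul_cancel₀ _ (by positivity)]
      have : 0 < l * L ^ 3 := by positivity
      linarith
    obtain ⟨r, hr, hr'⟩ := (hE₁ l').1
    have hr0 := hr.1
    rw [← hr']
    have h1 := hE₂le l' (L / 3) (by positivity) (by linarith)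
    refine h1.trans ?_
    unfold energyTwo stepCost
    have h2 : L / 3 / (1 + L / 3) ≤ 1 := by
      rw [div_le_one (by positivity)]; linarith
    have h3 : 0 ≤ r / (1 + r) := by positivity
    have h4 : L ^ 3 / 4 ≤ r ^ 3 + (L - r) ^ 3 := by nlinarith [mul_nonneg hL.le (sq_nonneg (L - 2 * r))]
    have h5 := mul_le_mul_of_nonneg_left h4 (hl0.trans_le hll').le
    simp only
    linarith
  obtain ⟨lam, hlam, htie⟩ := intermediate_value_Icc' hll' ((hE₂c.sub hE₁c).continuousOn)
    (show (0 : ℝ) ∈ Icc (E₂ l' - E₁ l') (E₂ l - E₁ l) from ⟨by linarith, by linarith⟩)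
  have htie : E₂ lam = E₁ lam := sub_eq_zero.1 htie
  have hlam0 : 0 < lam := hl0.trans_le hlam.1
  -- Strictness excludes r = 0 as an optimal height, so the minimisers at the tie really have one
  -- and two jumps.
  have hlt : E₁ lam < lam * L ^ 3 / 24 := by
    refine (hE₁le lam (p / 2) (by positivity) (by linarith)).trans_lt ?_
    rw [← sub_neg, energyOne_sub (by positivity)]
    refine mul_neg_of_pos_of_neg (by positivity) (sub_neg.2 ?_)
    rw [div_lt_iff₀ (by positivity)]
    have h1 : p * (1 + p) < L * (2 * L - p) := by nlinarith
    have h2 := mul_lt_mul_of_pos_left h1 (by positivity : 0 < l * (2 + p))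
    have h3 : l * (L * (L - p / 2) * (1 + p / 2)) ≤ lam * (L * (L - p / 2) * (1 + p / 2)) :=
      mul_le_mul_of_nonneg_right hlam.1
        (mul_nonneg (mul_nonneg hL.le (by linarith)) (by positivity))
    linarith
  obtain ⟨r₁, hr₁, hr₁E⟩ := (hE₁ lam).1
  obtain ⟨r₂, hr₂, hr₂E⟩ := (hE₂ lam).1
  change energyOne L lam r₁ = E₁ lam at hr₁E
  change energyTwo L lam r₂ = E₂ lam at hr₂E
  refine ⟨lam, hlam0, r₁, r₂, lt_of_le_of_ne hr₁.1 ?_, hr₁.2, lt_of_le_of_ne hr₂.1 ?_,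
    by linarith [hr₂.2], by rw [hr₁E, hr₂E, htie], fun r h0 h1 => hr₁E ▸ hE₁le lam r h0 h1,
    fun r h0 h1 => hr₂E ▸ hE₂le lam r h0 h1⟩
  · rintro rfl
    simp only [energyOne, stepCost_zero, sub_zero, zero_add] at hr₁E
    linarith
  · rintro rfl
    simp only [energyTwo, stepCost_zero, mul_zero, sub_zero, zero_add] at hr₂E
    linarith

/-! ### The explicit tie with boundary values -/

/-- For the explicit `lam` one jump and two jumps cost the same, and no other way to cover the height
`L` is cheaper. -/
theorem stepCost_eq_of_explicit {L lam : ℝ} (hL : 0 < L)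
    (hlam : lam = 32 / (L * (L + 1) * (L + 2))) :
    2 * stepCost lam (L / 2) = stepCost lam L := by
  rw [hlam]
  unfold stepCost
  field_simp
  ring

theorem stepCost_le_sum_of_explicit {ι : Type*} {L lam : ℝ} (hL : 0 < L)
    (hlam : lam = 32 / (L * (L + 1) * (L + 2))) (s : Finset ι) (ρ : ι → ℝ)
    (hρ : ∀ i ∈ s, 0 ≤ ρ i) (hP : ∑ i ∈ s, ρ i = L) :
    stepCost lam L ≤ ∑ i ∈ s, stepCost lam (ρ i) := by
  have hlam0 : 0 < lam := by rw [hlam]; positivity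
  have he := stepCost_eq_of_explicit hL hlam
  obtain ⟨r₀, h0, hr₀⟩ := exists_unitCost_critical hlam0
  -- If L/2 > r₀, the unit cost would be strictly larger at L than at L/2, contradicting the tie.
  have hL' : L ≤ 2 * r₀ := by
    by_contra! hcon
    have h5 := unitCost_strictMono hlam0 h0 hr₀ (x := L / 2) (y := L) (by linarith) (by linarith)
    have h7 := mul_lt_mul_of_pos_left h5 hL
    rw [stepCost_eq, stepCost_eq] at he
    linarith
  have := min_le_sum_stepCost hlam0 hr₀ s ρ hρ (by rw [hP]; exact hL')
  rwa [hP, he, min_self] at this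

/-! ### Sorting a discrete path -/

/-- The total cost of the jumps along the path that visits the entries of a list in order. -/
noncomputable def pathCost (k : ℝ → ℝ) : List ℝ → ℝ
  | x :: y :: l => k |x - y| + pathCost k (y :: l)
  | _ => 0

theorem pathCost_cons_cons (k : ℝ → ℝ) (x y : ℝ) (l : List ℝ) :
    pathCost k (x :: y :: l) = k |x - y| + pathCost k (y :: l) := rfl

theorem pathCost_singleton (k : ℝ → ℝ) (x : ℝ) : pathCost k [x] = 0 := rfl

/-- Inserting x at an end of a sorted list adds a link no longer than |x - w|. Inserting it between
two neighbours replaces their link by two: the one pointing away from w is no longer than the old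
link, the one pointing towards w no longer than |x - w|. Monotonicity of k is enough; in the
insertion sort w is the old successor of x. -/
theorem pathCost_orderedInsert_le {k : ℝ → ℝ} (hk : MonotoneOn k (Ici 0)) (x : ℝ) :
    ∀ (l : List ℝ), l.Pairwise (· ≤ ·) → ∀ w ∈ l,
      pathCost k (l.orderedInsert (· ≤ ·) x) ≤ pathCost k l + k |x - w| := by
  have hk' : ∀ s t : ℝ, |s| ≤ |t| → k |s| ≤ k |t| := fun s t h =>
    hk (mem_Ici.2 (abs_nonneg _)) (mem_Ici.2 (abs_nonneg _)) h
  intro l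
  induction l with
  | nil => simp
  | cons z l ih =>
    intro hl w hw
    rw [List.pairwise_cons] at hl
    rcases le_or_gt x z with hxz | hxz
    · rw [List.orderedInsert_cons_of_le _ _ hxz, pathCost_cons_cons]
      have hzw : z ≤ w := by
        rcases List.mem_cons.1 hw with rfl | hw
        · exact le_rfl
        · exact hl.1 w hw
      have := hk' (x - z) (x - w) (by
        rw [abs_sub_comm, abs_sub_comm x w, abs_of_nonneg, abs_of_nonneg] <;> linarith)
      linarith
    · rw [List.orderedInsert_of_not_le _ _ hxz.not_ge]
      cases l with
      | nil =>
        rw [List.orderedInsert_nil, pathCost_cons_cons, pathCost_singleton, pathCost_singleton]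
        rw [List.mem_singleton] at hw
        rw [hw, abs_sub_comm]
        linarith
      | cons z' l =>
        have hzz' : z ≤ z' := hl.1 z' List.mem_cons_self
        rcases le_or_gt x z' with hxz' | hxz'
        · rw [List.orderedInsert_cons_of_le _ _ hxz', pathCost_cons_cons, pathCost_cons_cons,
            pathCost_cons_cons]
          rcases List.mem_cons.1 hw with rfl | hw
          · have := hk' (x - z') (w - z') (by
              rw [abs_sub_comm, abs_sub_comm w, abs_of_nonneg, abs_of_nonneg] <;> linarith)
            rw [abs_sub_comm w x]
            linarith
          · have hzw : z' ≤ w := by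
              rcases List.mem_cons.1 hw with rfl | hw
              · exact le_rfl
              · exact (List.pairwise_cons.1 hl.2).1 w hw
            have h1 := hk' (z - x) (z - z') (by
              rw [abs_sub_comm, abs_sub_comm z z', abs_of_nonneg, abs_of_nonneg] <;> linarith)
            have h2 := hk' (x - z') (x - w) (by
              rw [abs_sub_comm, abs_sub_comm x w, abs_of_nonneg, abs_of_nonneg] <;> linarith)
            linarith
        · have hins : List.orderedInsert (· ≤ ·) x (z' :: l) =
              z' :: List.orderedInsert (· ≤ ·) x l := List.orderedInsert_of_not_le _ _ hxz'.not_ge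
          rcases List.mem_cons.1 hw with rfl | hw
          · have h1 := ih hl.2 z' List.mem_cons_self
            have h2 := hk' (x - z') (x - w) (by
              rw [abs_of_nonneg, abs_of_nonneg] <;> linarith)
            rw [hins] at h1 ⊢
            rw [pathCost_cons_cons, pathCost_cons_cons]
            linarith
          · have h1 := ih hl.2 w hw
            rw [hins] at h1 ⊢
            rw [pathCost_cons_cons, pathCost_cons_cons]
            linarith

theorem pathCost_insertionSort_le {k : ℝ → ℝ} (hk : MonotoneOn k (Ici 0)) :
    ∀ l : List ℝ, pathCost k (l.insertionSort (· ≤ ·)) ≤ pathCost k l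
  | [] => le_rfl
  | [x] => le_rfl
  | x :: y :: l => by
    rw [List.insertionSort_cons, pathCost_cons_cons]
    have h1 := pathCost_insertionSort_le hk (y :: l)
    have h2 := pathCost_orderedInsert_le hk x _ (List.pairwise_insertionSort (· ≤ ·) (y :: l)) y
      ((List.mem_insertionSort _).2 List.mem_cons_self)
    linarith

theorem pathCost_ofFn (k : ℝ → ℝ) : ∀ (n : ℕ) (y : Fin (n + 1) → ℝ),
    pathCost k (List.ofFn y) = ∑ i : Fin n, k |y i.castSucc - y i.succ|
  | 0, y => by simp [pathCost]
  | n + 1, y => by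
    have h := pathCost_ofFn k n (fun i => y i.succ)
    rw [List.ofFn_succ, List.ofFn_succ, pathCost_cons_cons, Fin.sum_univ_succ]
    rw [List.ofFn_succ] at h
    rw [h]
    rfl

theorem sum_sort_le {k : ℝ → ℝ} (hk : MonotoneOn k (Ici 0)) {n : ℕ} (y : Fin (n + 1) → ℝ) :
    ∑ i : Fin n, k |y (Tuple.sort y i.castSucc) - y (Tuple.sort y i.succ)| ≤
      ∑ i : Fin n, k |y i.castSucc - y i.succ| := by
  have h : List.ofFn (y ∘ Tuple.sort y) = (List.ofFn y).insertionSort (· ≤ ·) := by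
    refine List.Perm.eq_of_pairwise' (r := (· ≤ ·)) ?_ (List.pairwise_insertionSort _ _)
      (((Tuple.sort y).ofFn_comp_perm y).trans (List.perm_insertionSort _ _).symm)
    exact (Tuple.monotone_sort y).sortedLE_ofFn.pairwise
  have h1 := pathCost_insertionSort_le hk (List.ofFn y)
  rw [← h, pathCost_ofFn, pathCost_ofFn] at h1
  exact h1

/-- Rearrangement inequality: the sums of squares agree, and sorting y along the monotone ξ
maximises the cross term. -/
theorem sum_sq_sort_le {n : ℕ} (y ξ : Fin n → ℝ) (hξ : Monotone ξ) :
    ∑ i, (y (Tuple.sort y i) - ξ i) ^ 2 ≤ ∑ i, (y i - ξ i) ^ 2 := by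
  have hm : Monovary (y ∘ Tuple.sort y) ξ := (Tuple.monotone_sort y).monovary hξ
  have h := hm.sum_comp_perm_mul_le_sum_mul (σ := (Tuple.sort y)⁻¹)
  have e : ∀ x, Tuple.sort y ((Tuple.sort y)⁻¹ x) = x := (Tuple.sort y).apply_symm_apply
  simp only [Function.comp_apply, e] at h
  have h2 : ∑ i, y (Tuple.sort y i) ^ 2 = ∑ i, y i ^ 2 :=
    Equiv.sum_comp (Tuple.sort y) fun i => y i ^ 2
  simp only [sub_sq, Finset.sum_add_distrib, Finset.sum_sub_distrib, mul_assoc, ← Finset.mul_sum]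
  rw [h2]
  linarith

/-! ### From a discrete path to jump heights -/

theorem monotoneOn_div_one_add : MonotoneOn (fun ρ : ℝ => ρ / (1 + ρ)) (Ici 0) := by
  intro x hx y hy hxy
  have hx : 0 ≤ x := hx
  have hy : 0 ≤ y := hy
  simp only
  rw [div_le_div_iff₀ (by positivity) (by positivity)]
  nlinarith

/-- The cubes give the exact integral of (t - z)² over the cell; replacing it by the value at one
point ξ of the cell costs an error of order h², which sums to order h over the grid. -/
theorem cell_fidelity_ge {L h x z ξ : ℝ} (hh : 0 ≤ h) (hξ : x ≤ ξ) (hξ' : ξ ≤ x + h)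
    (h1 : |x - z| ≤ L) (h2 : |x + h - z| ≤ L) :
    ((x + h - z) ^ 3 - (x - z) ^ 3) / 3 - 2 * L * h ^ 2 ≤ h * (z - ξ) ^ 2 := by
  obtain ⟨A, hA⟩ : ∃ A, A = x - z := ⟨_, rfl⟩
  obtain ⟨s, hs⟩ : ∃ s, s = ξ - x := ⟨_, rfl⟩
  rw [show x + h - z = A + h by rw [hA]; ring, ← hA]
  rw [show x + h - z = A + h by rw [hA]; ring] at h2
  rw [← hA] at h1
  rw [show z - ξ = -(A + s) by rw [hA, hs]; ring]
  rw [abs_le] at h1 h2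
  have hs0 : 0 ≤ s := by linarith
  have hsh : s ≤ h := by linarith
  have h3 : ((A + h) ^ 3 - A ^ 3) / 3 - 2 * L * h ^ 2 - h * (-(A + s)) ^ 2 =
      h * (A * (h - 2 * s) + h ^ 2 / 3 - s ^ 2 - 2 * L * h) := by ring
  have h4 : A * (h - 2 * s) + h ^ 2 / 3 - s ^ 2 - 2 * L * h ≤ 0 := by
    have hL : 0 ≤ L := by linarith
    have hhL : h ≤ 2 * L := by linarith
    have h5 : A * (h - 2 * s) ≤ L * h := by
      rcases le_total 0 (h - 2 * s) with h6 | h6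
      · exact (mul_le_mul_of_nonneg_right h1.2 h6).trans (mul_le_mul_of_nonneg_left (by linarith) hL)
      · have := mul_le_mul_of_nonpos_right h1.1 h6
        nlinarith
    nlinarith
  have := mul_nonpos_of_nonneg_of_nonpos hh h4
  linarith

theorem abs_clip_sub_clip_le {a b : ℝ} (x y : ℝ) :
    |max a (min b x) - max a (min b y)| ≤ |x - y| := by
  calc |max a (min b x) - max a (min b y)| ≤ |min b x - min b y| := by
        simpa [max_comm a] using abs_max_sub_max_le_abs (min b x) (min b y) a
    _ ≤ |x - y| := by
        have := abs_min_sub_min_le_max b x b y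
        simpa using this

/-- Lower bound for the discrete energy of an arbitrary path `y` sampled at points `ξ i` of the cells
of a uniform grid of mesh `h`: clip the path to `[a, b]`, sort it, and sum by parts. -/
theorem discrete_energy_ge {a h lam : ℝ} {n : ℕ} (hh : 0 < h) (hlam : 0 < lam)
    (y ξ : Fin (n + 1) → ℝ)
    (hξ : ∀ i, a + i * h ≤ ξ i) (hξ' : ∀ i, ξ i ≤ a + i * h + h) :
    ∃ (ρ : Fin n → ℝ) (e₁ e₂ : ℝ), (∀ i, 0 ≤ ρ i) ∧ 0 ≤ e₁ ∧ 0 ≤ e₂ ∧ e₁ ≤ |y 0 - a| ∧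
      e₂ ≤ |y (Fin.last n) - (a + (n + 1) * h)| ∧ e₁ + e₂ + ∑ i, ρ i = (n + 1) * h ∧
      ∑ i, stepCost lam (ρ i) + lam / 6 * (e₁ ^ 3 + e₂ ^ 3) - lam * ((n + 1) * h) ^ 2 * h ≤
        ∑ i : Fin n, (fun ρ : ℝ => ρ / (1 + ρ)) |y i.castSucc - y i.succ| +
          lam / 2 * (h * ∑ i, (y i - ξ i) ^ 2) := by
  obtain ⟨b, hb⟩ : ∃ b, b = a + (n + 1) * h := ⟨_, rfl⟩
  obtain ⟨L, hL⟩ : ∃ L, L = (n + 1) * h := ⟨_, rfl⟩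
  have hbL : b = a + L := by rw [hb, hL]
  rw [← hb, ← hL]
  have hL0 : 0 < L := by rw [hL]; positivity
  let y' : Fin (n + 1) → ℝ := fun i => max a (min b (y i))
  let z : Fin (n + 1) → ℝ := y' ∘ Tuple.sort y'
  have hz : Monotone z := Tuple.monotone_sort y'
  have hab : a ≤ b := by linarith
  have hy'a : ∀ i, a ≤ y' i := fun i => le_max_left _ _
  have hy'b : ∀ i, y' i ≤ b := fun i => max_le hab (min_le_left _ _)
  have hza : ∀ i, a ≤ z i := fun i => hy'a _
  have hzb : ∀ i, z i ≤ b := fun i => hy'b _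
  have hgrid : ∀ i : Fin (n + 1), a ≤ a + i * h ∧ a + i * h + h ≤ b := by
    intro i
    have h1 : (i : ℝ) + 1 ≤ n + 1 := by exact_mod_cast i.2
    have h2 : 0 ≤ (i : ℝ) * h := by positivity
    have h3 := mul_le_mul_of_nonneg_right h1 hh.le
    constructor
    · linarith
    · rw [hb]; linarith
  have hξm : Monotone ξ := by
    intro i j hij
    rcases hij.eq_or_lt with rfl | hij
    · exact le_rfl
    · have h1 : (i : ℝ) + 1 ≤ j := by exact_mod_cast hij
      have h2 := mul_le_mul_of_nonneg_right h1 hh.le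
      linarith [hξ' i, hξ j]
  have hclipξ : ∀ i, max a (min b (ξ i)) = ξ i := fun i => by
    rw [min_eq_right ((hξ' i).trans (hgrid i).2), max_eq_right ((hgrid i).1.trans (hξ i))]
  have hzmem : ∀ i, ∃ j, z j = y' i := fun i => ⟨(Tuple.sort y').symm i, by simp [z]⟩
  refine ⟨fun i => z i.succ - z i.castSucc, z 0 - a, b - z (Fin.last n),
    fun i => sub_nonneg.2 (hz i.castSucc_le_succ), sub_nonneg.2 (hza _), sub_nonneg.2 (hzb _),
    ?_, ?_, ?_, ?_⟩
  · obtain ⟨j, hj⟩ := hzmem 0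
    have h1 : z 0 ≤ y' 0 := hj ▸ hz (Fin.zero_le j)
    have h2 := abs_clip_sub_clip_le (a := a) (b := b) (y 0) a
    rw [min_eq_right hab, max_self] at h2
    exact (sub_le_sub_right h1 a).trans ((le_abs_self _).trans h2)
  · obtain ⟨j, hj⟩ := hzmem (Fin.last n)
    have h1 : y' (Fin.last n) ≤ z (Fin.last n) := hj ▸ hz (Fin.le_last j)
    have h2 := abs_clip_sub_clip_le (a := a) (b := b) (y (Fin.last n)) b
    rw [min_self, max_eq_right hab, abs_sub_comm] at h2
    exact (sub_le_sub_left h1 b).trans ((le_abs_self _).trans h2)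
  · have h1 : ∑ i : Fin n, (z i.succ - z i.castSucc) = z (Fin.last n) - z 0 := by
      have e1 := Fin.sum_univ_succ z
      have e2 := Fin.sum_univ_castSucc z
      rw [Finset.sum_sub_distrib]
      linarith
    rw [h1]
    linarith
  · have s1 : ∑ i : Fin n, (fun ρ : ℝ => ρ / (1 + ρ)) |z i.castSucc - z i.succ| ≤
        ∑ i : Fin n, (fun ρ : ℝ => ρ / (1 + ρ)) |y i.castSucc - y i.succ| :=
      (sum_sort_le monotoneOn_div_one_add y').trans (Finset.sum_le_sum fun i _ =>
        monotoneOn_div_one_add (mem_Ici.2 (abs_nonneg _)) (mem_Ici.2 (abs_nonneg _))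
          (abs_clip_sub_clip_le _ _))
    have s2 : ∑ i, (z i - ξ i) ^ 2 ≤ ∑ i, (y i - ξ i) ^ 2 :=
      (sum_sq_sort_le y' ξ hξm).trans (Finset.sum_le_sum fun i _ => by
        have := abs_clip_sub_clip_le (a := a) (b := b) (y i) (ξ i)
        rw [hclipξ] at this
        exact sq_le_sq.2 this)
    have s3 : ∑ i : Fin (n + 1), (((a + i * h + h - z i) ^ 3 - (a + i * h - z i) ^ 3) / 3 -
        2 * L * h ^ 2) ≤ h * ∑ i, (z i - ξ i) ^ 2 := by
      rw [Finset.mul_sum]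
      refine Finset.sum_le_sum fun i _ => cell_fidelity_ge hh.le (hξ i) (hξ' i) ?_ ?_
      · have := hgrid i
        rw [abs_le]; constructor <;> linarith [hza i, hzb i]
      · have := hgrid i
        rw [abs_le]; constructor <;> linarith [hza i, hzb i]
    -- Summation by parts: the right end of each cell is the left end of the next, so the cubes
    -- regroup at the n interior grid points, leaving one cube at each end.
    have s4 : ∑ i : Fin (n + 1), (((a + i * h + h - z i) ^ 3 - (a + i * h - z i) ^ 3) / 3 -
        2 * L * h ^ 2) = ((z 0 - a) ^ 3 + (b - z (Fin.last n)) ^ 3) / 3 +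
          ∑ i : Fin n, ((a + i * h + h - z i.castSucc) ^ 3 - (a + i * h + h - z i.succ) ^ 3) / 3 -
          2 * L ^ 2 * h := by
      rw [Finset.sum_sub_distrib, ← Finset.sum_div, Finset.sum_sub_distrib,
        Fin.sum_univ_castSucc (fun i : Fin (n + 1) => (a + i * h + h - z i) ^ 3),
        Fin.sum_univ_succ (fun i : Fin (n + 1) => (a + i * h - z i) ^ 3), ← Finset.sum_div,
        Finset.sum_sub_distrib]
      simp only [Finset.sum_const, Finset.card_univ, Fintype.card_fin, nsmul_eq_mul,
        Fin.val_castSucc, Fin.val_succ, Fin.val_zero, Fin.val_last, Nat.cast_add, Nat.cast_one,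
        Nat.cast_zero, add_mul, one_mul, ← add_assoc]
      have : (n : ℝ) * h = L - h := by rw [hL]; ring
      rw [show (n : ℝ) * (2 * L * h ^ 2) = 2 * L * h * (n * h) by ring, this, hbL]
      ring
    -- With A - B = ρ one has A³ - B³ = ρ(A² + AB + B²) ≥ ρ³/4, with equality for A = -B, a jump
    -- located where g is the mean of the two values.
    have s5 : ∑ i : Fin n, (z i.succ - z i.castSucc) ^ 3 / 12 ≤
        ∑ i : Fin n, ((a + i * h + h - z i.castSucc) ^ 3 - (a + i * h + h - z i.succ) ^ 3) / 3 := by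
      refine Finset.sum_le_sum fun i _ => ?_
      have h0 := hz i.castSucc_le_succ
      nlinarith [mul_nonneg (sub_nonneg.2 h0)
        (sq_nonneg ((a + i * h + h - z i.castSucc) + (a + i * h + h - z i.succ)))]
    have s6 : ∑ i : Fin n, stepCost lam (z i.succ - z i.castSucc) =
        ∑ i : Fin n, (fun ρ : ℝ => ρ / (1 + ρ)) |z i.castSucc - z i.succ| +
          lam / 2 * ∑ i : Fin n, (z i.succ - z i.castSucc) ^ 3 / 12 := by
      rw [Finset.mul_sum, ← Finset.sum_add_distrib]
      refine Finset.sum_congr rfl fun i _ => ?_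
      rw [abs_sub_comm, abs_of_nonneg (sub_nonneg.2 (hz i.castSucc_le_succ))]
      unfold stepCost
      ring
    rw [s6]
    have s7 := mul_le_mul_of_nonneg_left (s4 ▸ s3) (by positivity : 0 ≤ lam / 2)
    have s8 := mul_le_mul_of_nonneg_left s5 (by positivity : 0 ≤ lam / 2)
    have s9 := mul_le_mul_of_nonneg_left (mul_le_mul_of_nonneg_left s2 hh.le)
      (by positivity : 0 ≤ lam / 2)
    linarith

/-! ### BV functions as distribution functions of signed measures -/

theorem integrable_deriv_of_test {φ : ℝ → ℝ} (hφ : ContDiff ℝ ∞ φ) (hc : HasCompactSupport φ) :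
    Integrable (deriv φ) :=
  (hφ.continuous_deriv (by simp)).integrable_of_hasCompactSupport hc.deriv

theorem integral_Ico_deriv_of_test {b y : ℝ} {φ : ℝ → ℝ} (hφ : ContDiff ℝ ∞ φ)
    (hc : HasCompactSupport φ) (hb : φ b = 0) (hy : y ≤ b) :
    ∫ x in Ico y b, deriv φ x = -φ y := by
  rw [integral_Ico_eq_integral_Ioo, ← integral_Ioc_eq_integral_Ioo,
    ← intervalIntegral.integral_of_le hy,
    intervalIntegral.integral_deriv_eq_sub (fun x _ => (hφ.differentiable (by simp)) x)
      (integrable_deriv_of_test hφ hc).intervalIntegrable, hb, zero_sub]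

theorem integral_Ioo_deriv_of_test {a b : ℝ} (hab : a < b) {φ : ℝ → ℝ} (hφ : ContDiff ℝ ∞ φ)
    (hc : HasCompactSupport φ) (hs : tsupport φ ⊆ Ioo a b) :
    ∫ x in Ioo a b, deriv φ x = 0 := by
  have h0 : ∀ y, y ∉ Ioo a b → φ y = 0 := fun y hy =>
    image_eq_zero_of_notMem_tsupport fun h => hy (hs h)
  rw [← integral_Ico_eq_integral_Ioo, integral_Ico_deriv_of_test hφ hc (h0 b (by simp)) hab.le,
    h0 a (by simp), neg_zero]

theorem integrable_uncurry_indicator {a b : ℝ} (P : Measure ℝ) [IsFiniteMeasure P]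
    {φ : ℝ → ℝ} (hφ : ContDiff ℝ ∞ φ) (hc : HasCompactSupport φ) :
    Integrable (Function.uncurry fun x y : ℝ => (Ioc a x).indicator (fun _ => deriv φ x) y)
      ((volume.restrict (Ioo a b)).prod P) := by
  have e : (Function.uncurry fun x y : ℝ => (Ioc a x).indicator (fun _ => deriv φ x) y) =
      indicator {p : ℝ × ℝ | a < p.2 ∧ p.2 ≤ p.1} (fun p => deriv φ p.1) := by
    ext ⟨x, y⟩
    simp [indicator, Function.uncurry]
  rw [e]
  refine Integrable.indicator ?_ ?_
  · exact (integrable_deriv_of_test hφ hc).restrict.comp_fst P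
  · exact (measurableSet_lt measurable_const measurable_snd).inter
      (measurableSet_le measurable_snd measurable_fst)

theorem integrable_cdf_mul_deriv {a b : ℝ} (P : Measure ℝ) [IsFiniteMeasure P]
    {φ : ℝ → ℝ} (hφ : ContDiff ℝ ∞ φ) (hc : HasCompactSupport φ) :
    IntegrableOn (fun x => P.real (Ioc a x) * deriv φ x) (Ioo a b) := by
  have h := (integrable_uncurry_indicator (a := a) (b := b) P hφ hc).integral_prod_left
  simp only [Function.uncurry_apply_pair, integral_indicator_const _ measurableSet_Ioc,
    smul_eq_mul] at h
  exact h

/-- Integration by parts against the distribution function of a finite measure. -/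
theorem integral_cdf_mul_deriv {a b : ℝ} (P : Measure ℝ) [IsFiniteMeasure P]
    {φ : ℝ → ℝ} (hφ : ContDiff ℝ ∞ φ) (hc : HasCompactSupport φ) (hs : tsupport φ ⊆ Ioo a b) :
    ∫ x in Ioo a b, P.real (Ioc a x) * deriv φ x = -∫ y, φ y ∂P := by
  have h0 : ∀ y, y ∉ Ioo a b → φ y = 0 := fun y hy =>
    image_eq_zero_of_notMem_tsupport fun h => hy (hs h)
  -- Writing the mass of (a, x] as an integral over y, Fubini leaves for each y the integral of φ'
  -- over [y, b), which is -φ(y).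
  have h := integral_integral_swap (integrable_uncurry_indicator (a := a) (b := b) P hφ hc)
  simp only [integral_indicator_const _ measurableSet_Ioc, smul_eq_mul] at h
  rw [h, ← integral_neg]
  refine integral_congr_ae (ae_of_all _ fun y => ?_)
  simp only
  by_cases hy : y ∈ Ioo a b
  · have e : ∀ x, (Ioc a x).indicator (fun _ => deriv φ x) y = (Ici y).indicator (deriv φ) x := by
      intro x
      simp [indicator, hy.1]
    simp only [e]
    rw [setIntegral_indicator measurableSet_Ici]
    have e2 : Ioo a b ∩ Ici y = Ico y b := by
      ext x
      simp only [mem_inter_iff, mem_Ioo, mem_Ici, mem_Ico]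
      constructor
      · rintro ⟨⟨_, h1⟩, h2⟩; exact ⟨h2, h1⟩
      · rintro ⟨h1, h2⟩; exact ⟨⟨hy.1.trans_le h1, h2⟩, h1⟩
    rw [e2, integral_Ico_deriv_of_test hφ hc (h0 b (by simp)) hy.2.le]
  · rw [h0 y hy, neg_zero]
    refine setIntegral_eq_zero_of_forall_eq_zero fun x hx => ?_
    refine indicator_of_notMem (fun h' => hy ⟨h'.1, h'.2.trans_lt hx.2⟩) _

theorem signedMeasure_apply (μ : SignedMeasure ℝ) {s : Set ℝ} (hs : MeasurableSet s) :
    μ s = μ.toJordanDecomposition.posPart.real s - μ.toJordanDecomposition.negPart.real s :=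
  μ.apply_eq_posPart_real_sub_negPart_real hs

/-- The function `x ↦ c + μ (a, x]` has distributional derivative `μ`. -/
theorem hasDistribDeriv_primitive {a b : ℝ} (hab : a < b) (c : ℝ) (μ : SignedMeasure ℝ) :
    HasDistribDeriv a b (fun x => c + μ (Ioc a x)) μ := by
  intro φ hφ hc hs
  have e : ∀ x, (c + μ (Ioc a x)) * deriv φ x = c * deriv φ x +
      (μ.toJordanDecomposition.posPart.real (Ioc a x) * deriv φ x -
        μ.toJordanDecomposition.negPart.real (Ioc a x) * deriv φ x) := by
    intro x
    rw [signedMeasure_apply μ measurableSet_Ioc]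
    ring
  simp only [e]
  have i1 := integrable_cdf_mul_deriv (a := a) (b := b) μ.toJordanDecomposition.posPart hφ hc
  have i2 := integrable_cdf_mul_deriv (a := a) (b := b) μ.toJordanDecomposition.negPart hφ hc
  have i3 : IntegrableOn (fun x => μ.toJordanDecomposition.posPart.real (Ioc a x) * deriv φ x -
        μ.toJordanDecomposition.negPart.real (Ioc a x) * deriv φ x) (Ioo a b) := i1.sub i2
  rw [integral_add ((integrable_deriv_of_test hφ hc).restrict.const_mul c) i3,
    integral_sub i1 i2, integral_const_mul, integral_Ioo_deriv_of_test hab hφ hc hs,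
    integral_cdf_mul_deriv _ hφ hc hs, integral_cdf_mul_deriv _ hφ hc hs]
  ring

theorem integrableOn_mul_of_test {s : Set ℝ} {w g : ℝ → ℝ} (hw : IntegrableOn w s)
    (hg : Continuous g) (hc : HasCompactSupport g) : IntegrableOn (fun x => w x * g x) s := by
  obtain ⟨C, hC⟩ := hg.bounded_above_of_compact_support hc
  exact Integrable.mul_bdd (c := C) hw hg.aestronglyMeasurable (ae_of_all _ hC)

theorem exists_primitive_test {a b : ℝ} {θ : ℝ → ℝ} (hθ : ContDiff ℝ ∞ θ) {K : Set ℝ}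
    (hK : IsCompact K) (hKne : K.Nonempty) (hKab : K ⊆ Ioo a b) (hθK : Function.support θ ⊆ K)
    (hint : ∫ x, θ x = 0) :
    ∃ φ : ℝ → ℝ, ContDiff ℝ ∞ φ ∧ HasCompactSupport φ ∧ tsupport φ ⊆ Ioo a b ∧ deriv φ = θ := by
  obtain ⟨p, hp, hp'⟩ := hK.exists_isLeast hKne
  obtain ⟨q, hq, hq'⟩ := hK.exists_isGreatest hKne
  let φ : ℝ → ℝ := fun x => ∫ t in a..x, θ t
  have hd : ∀ x, HasDerivAt φ (θ x) x := fun x =>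
    intervalIntegral.integral_hasDerivAt_right (hθ.continuous.intervalIntegrable _ _)
      hθ.continuous.stronglyMeasurable.stronglyMeasurableAtFilter hθ.continuous.continuousAt
  have hderiv : deriv φ = θ := funext fun x => (hd x).deriv
  have hsupp : Function.support φ ⊆ Icc p q := by
    intro x hx
    by_contra hcon
    refine hx ?_
    rw [mem_Icc, not_and_or, not_le, not_le] at hcon
    rcases hcon with h | h
    · refine intervalIntegral.integral_zero_ae (ae_of_all _ fun t ht => ?_)
      by_contra hne
      have h1 := hp' (hθK hne)
      have h2 := (hKab hp).1
      rcases le_total a x with h3 | h3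
      · rw [uIoc_of_le h3] at ht; linarith [ht.2]
      · rw [uIoc_of_ge h3] at ht; linarith [ht.2]
    · change ∫ t in a..x, θ t = 0
      rw [intervalIntegral.integral_eq_integral_of_support_subset, hint]
      intro t ht
      exact ⟨(hKab (hθK ht)).1, (hq' (hθK ht)).trans h.le⟩
  have hts : tsupport φ ⊆ Icc p q := closure_minimal hsupp isClosed_Icc
  refine ⟨φ, ?_, HasCompactSupport.of_support_subset_isCompact isCompact_Icc hsupp,
    hts.trans fun x hx => ⟨(hKab hp).1.trans_le hx.1, hx.2.trans_lt (hKab hq).2⟩, hderiv⟩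
  exact contDiff_infty_iff_deriv.2 ⟨fun x => (hd x).differentiableAt, hderiv ▸ hθ⟩

/-- A function whose distributional derivative vanishes is constant. -/
theorem ae_eq_const_of_integral_mul_deriv_eq_zero {a b : ℝ} (hab : a < b) {w : ℝ → ℝ}
    (hw : IntegrableOn w (Ioo a b))
    (h : ∀ φ : ℝ → ℝ, ContDiff ℝ ∞ φ → HasCompactSupport φ → tsupport φ ⊆ Ioo a b →
      ∫ x in Ioo a b, w x * deriv φ x = 0) :
    ∃ c : ℝ, ∀ᵐ x ∂volume.restrict (Ioo a b), w x = c := by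
  let η : ContDiffBump ((a + b) / 2 : ℝ) :=
    ⟨(b - a) / 8, (b - a) / 4, by linarith, by linarith⟩
  have hηs : tsupport (η.normed volume) ⊆ Ioo a b := by
    rw [η.tsupport_normed_eq]
    intro x hx
    rw [Metric.mem_closedBall, Real.dist_eq, abs_le] at hx
    have hr : η.rOut = (b - a) / 4 := rfl
    rw [hr] at hx
    constructor <;> linarith
  have hηc : ContDiff ℝ ∞ (η.normed volume) := η.contDiff_normed
  have hηk : HasCompactSupport (η.normed volume) := η.hasCompactSupport_normed
  have hη1 : ∫ x, η.normed volume x = 1 := η.integral_normed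
  have hηne : (tsupport (η.normed volume)).Nonempty := by
    rw [η.tsupport_normed_eq]
    exact Metric.nonempty_closedBall.2 η.rOut_pos.le
  set e := η.normed (volume : Measure ℝ)
  have hwe := integrableOn_mul_of_test hw hηc.continuous hηk
  refine ⟨∫ x in Ioo a b, w x * e x, ?_⟩
  set c := ∫ x in Ioo a b, w x * e x
  have hloc : LocallyIntegrableOn (fun x => w x - c) (Ioo a b) :=
    (hw.sub (integrableOn_const (by simp))).locallyIntegrableOn
  have hae := isOpen_Ioo.ae_eq_zero_of_integral_contDiff_smul_eq_zero hloc ?_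
  · rw [ae_restrict_iff' measurableSet_Ioo]
    filter_upwards [hae] with x hx hx'
    exact sub_eq_zero.1 (hx hx')
  intro g hg hgc hgs
  have hgi : Integrable g := hg.continuous.integrable_of_hasCompactSupport hgc
  have hei : Integrable e := hηc.continuous.integrable_of_hasCompactSupport hηk
  -- Subtracting (∫ g) e from the test function g makes the integral zero, so the difference is the
  -- derivative of an admissible test function.
  obtain ⟨φ, hφ, hφc, hφs, hφd⟩ := exists_primitive_test (a := a) (b := b)
    (θ := fun x => g x - (∫ t, g t) * e x) (hg.sub (contDiff_const.mul hηc))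
    (IsCompact.union hgc hηk) (hηne.mono subset_union_right) (union_subset hgs hηs)
    (by
      intro x hx
      by_contra hcon
      rw [mem_union, not_or] at hcon
      refine hx ?_
      simp only
      rw [image_eq_zero_of_notMem_tsupport hcon.1, image_eq_zero_of_notMem_tsupport hcon.2]
      simp)
    (by rw [integral_sub hgi (hei.const_mul _), integral_const_mul, hη1, mul_one, sub_self])
  have h1 := h φ hφ hφc hφs
  rw [hφd] at h1
  have hwg := integrableOn_mul_of_test hw hg.continuous hgc
  have e1 : ∀ x, w x * (g x - (∫ t, g t) * e x) = w x * g x - (∫ t, g t) * (w x * e x) :=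
    fun x => by ring
  simp only [e1] at h1
  rw [integral_sub hwg (hwe.const_mul _), integral_const_mul] at h1
  have e2 : ∫ x, g x • (w x - c) = ∫ x in Ioo a b, (w x * g x - c * g x) := by
    rw [← setIntegral_eq_integral_of_forall_compl_eq_zero (s := Ioo a b)]
    · refine integral_congr_ae (ae_of_all _ fun x => ?_)
      simp only [smul_eq_mul]
      ring
    · intro x hx
      rw [image_eq_zero_of_notMem_tsupport fun h => hx (hgs h), zero_smul]
  rw [e2, integral_sub hwg (hgi.restrict.const_mul _), integral_const_mul,
    setIntegral_eq_integral_of_forall_compl_eq_zero fun x hx =>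
      image_eq_zero_of_notMem_tsupport fun h => hx (hgs h)]
  linarith

theorem integrableOn_cdf {a b : ℝ} (P : Measure ℝ) [IsFiniteMeasure P] :
    IntegrableOn (fun x => P.real (Ioc a x)) (Ioo a b) := by
  have hm : Monotone fun x => P.real (Ioc a x) := fun x y hxy =>
    measureReal_mono (Ioc_subset_Ioc_right hxy)
  refine Measure.integrableOn_of_bounded (M := P.real univ) (by simp)
    hm.measurable.aestronglyMeasurable (ae_of_all _ fun x => ?_)
  rw [Real.norm_of_nonneg measureReal_nonneg]
  exact measureReal_mono (subset_univ _)

theorem integrableOn_primitive {a b : ℝ} (c : ℝ) (μ : SignedMeasure ℝ) :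
    IntegrableOn (fun x => c + μ (Ioc a x)) (Ioo a b) := by
  simp only [signedMeasure_apply μ measurableSet_Ioc]
  exact (integrableOn_const (by simp)).add ((integrableOn_cdf _).sub (integrableOn_cdf _))

/-- A function of bounded variation is a.e. the distribution function of its derivative. -/
theorem ae_eq_primitive {a b : ℝ} (hab : a < b) {u : ℝ → ℝ} (hu : IntegrableOn u (Ioo a b))
    {μ : SignedMeasure ℝ} (hμ : HasDistribDeriv a b u μ) :
    ∃ c : ℝ, ∀ᵐ x ∂volume.restrict (Ioo a b), u x = c + μ (Ioc a x) := by
  have hF := integrableOn_primitive (a := a) (b := b) 0 μ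
  obtain ⟨c, hc⟩ := ae_eq_const_of_integral_mul_deriv_eq_zero hab
    (w := fun x => u x - (0 + μ (Ioc a x))) (hu.sub hF) (by
      intro φ hφ hφc hφs
      have hd := hφ.continuous_deriv (by simp)
      simp only [sub_mul]
      rw [integral_sub (integrableOn_mul_of_test hu hd hφc.deriv)
        (integrableOn_mul_of_test hF hd hφc.deriv), hμ φ hφ hφc hφs,
        hasDistribDeriv_primitive hab 0 μ φ hφ hφc hφs, sub_self])
  refine ⟨c, hc.mono fun x hx => ?_⟩
  linarith

/-! ### Traces and the jump set -/

instance isFiniteMeasure_totalVariation (μ : SignedMeasure ℝ) :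
    IsFiniteMeasure μ.totalVariation := by
  unfold SignedMeasure.totalVariation
  infer_instance

theorem abs_signedMeasure_le (μ : SignedMeasure ℝ) {s : Set ℝ} (hs : MeasurableSet s) :
    |μ s| ≤ μ.totalVariation.real s := by
  rw [signedMeasure_apply μ hs, SignedMeasure.totalVariation, measureReal_add_apply]
  rw [abs_le]
  constructor <;> linarith [measureReal_nonneg (μ := μ.toJordanDecomposition.posPart) (s := s),
    measureReal_nonneg (μ := μ.toJordanDecomposition.negPart) (s := s)]

/-- The positive and negative parts are mutually singular, so at most one of them charges a given
point. -/
theorem totalVariation_singleton (μ : SignedMeasure ℝ) (x : ℝ) :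
    μ.totalVariation {x} = ENNReal.ofReal |μ {x}| := by
  rw [signedMeasure_apply μ (measurableSet_singleton x), SignedMeasure.totalVariation,
    Measure.add_apply]
  obtain ⟨s, -, h1, h2⟩ := μ.toJordanDecomposition.mutuallySingular
  by_cases hx : x ∈ s
  · have h3 := measure_mono_null (singleton_subset_iff.2 hx) h1
    simp [measureReal_def, h3]
  · have h3 := measure_mono_null (singleton_subset_iff.2 (mem_compl hx)) h2
    simp [measureReal_def, h3]

theorem tendsto_measure_Ioo_right (P : Measure ℝ) [IsFiniteMeasure P] (x : ℝ) :
    Tendsto (fun r => P.real (Ioo x (x + r))) (𝓝[>] 0) (𝓝 0) := by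
  have h := tendsto_measure_biInter_gt (μ := P) (s := fun r : ℝ => Ioo x (x + r)) (a := 0)
    (fun r _ => measurableSet_Ioo.nullMeasurableSet)
    (fun i j _ hij => Ioo_subset_Ioo_right (by linarith))
    ⟨1, one_pos, measure_ne_top _ _⟩
  have e : ⋂ r, ⋂ (_ : r > (0 : ℝ)), Ioo x (x + r) = ∅ := by
    refine eq_empty_of_forall_notMem fun y hy => ?_
    simp only [mem_iInter, mem_Ioo] at hy
    have h1 := (hy 1 one_pos).1
    have h2 := (hy (y - x) (by linarith)).2
    linarith
  rw [e, measure_empty] at h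
  exact (ENNReal.tendsto_toReal ENNReal.zero_ne_top).comp h

theorem tendsto_measure_Ioo_left (P : Measure ℝ) [IsFiniteMeasure P] (x : ℝ) :
    Tendsto (fun r => P.real (Ioo (x - r) x)) (𝓝[>] 0) (𝓝 0) := by
  have h := tendsto_measure_biInter_gt (μ := P) (s := fun r : ℝ => Ioo (x - r) x) (a := 0)
    (fun r _ => measurableSet_Ioo.nullMeasurableSet)
    (fun i j _ hij => Ioo_subset_Ioo_left (by linarith))
    ⟨1, one_pos, measure_ne_top _ _⟩
  have e : ⋂ r, ⋂ (_ : r > (0 : ℝ)), Ioo (x - r) x = ∅ := by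
    refine eq_empty_of_forall_notMem fun y hy => ?_
    simp only [mem_iInter, mem_Ioo] at hy
    have h1 := (hy 1 one_pos).2
    have h2 := (hy (x - y) (by linarith)).1
    linarith
  rw [e, measure_empty] at h
  exact (ENNReal.tendsto_toReal ENNReal.zero_ne_top).comp h

theorem abs_setAverage_le_of_ae {s : Set ℝ} {f : ℝ → ℝ} {C : ℝ} (hC : 0 ≤ C)
    (hs : volume s ≠ ⊤) (hf : ∀ᵐ y ∂volume.restrict s, |f y| ≤ C) : |⨍ y in s, f y| ≤ C := by
  have hfin : IsFiniteMeasure (volume.restrict s) := ⟨by simpa using hs.lt_top⟩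
  have h := norm_integral_le_of_norm_le_const (μ := volume.restrict s) (f := f) hf
  rw [average_eq, smul_eq_mul, abs_mul, abs_of_nonneg (inv_nonneg.2 measureReal_nonneg)]
  rw [Real.norm_eq_abs] at h
  calc _ ≤ ((volume.restrict s).real univ)⁻¹ * (C * (volume.restrict s).real univ) :=
        mul_le_mul_of_nonneg_left h (inv_nonneg.2 measureReal_nonneg)
    _ ≤ C := by
        rw [mul_left_comm]
        exact mul_le_of_le_one_right hC inv_mul_le_one

theorem tendsto_setAverage_zero {s : ℝ → Set ℝ} {f : ℝ → ℝ} {C : ℝ → ℝ}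
    (hs : ∀ r, volume (s r) ≠ ⊤) (hC : ∀ r, 0 ≤ C r) (hC0 : Tendsto C (𝓝[>] 0) (𝓝 0))
    (hf : ∀ᶠ r in 𝓝[>] (0 : ℝ), ∀ᵐ y ∂volume.restrict (s r), |f y| ≤ C r) :
    Tendsto (fun r => ⨍ y in s r, f y) (𝓝[>] 0) (𝓝 0) := by
  rw [tendsto_zero_iff_abs_tendsto_zero]
  refine tendsto_of_tendsto_of_tendsto_of_le_of_le' tendsto_const_nhds hC0
    (Eventually.of_forall fun r => abs_nonneg _) ?_
  exact hf.mono fun r hr => abs_setAverage_le_of_ae (hC r) (hs r) hr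

theorem signedMeasure_Ioc_sub (μ : SignedMeasure ℝ) {a x y : ℝ} (hax : a ≤ x) (hxy : x ≤ y) :
    μ (Ioc a y) - μ (Ioc a x) = μ (Ioc x y) := by
  rw [← Ioc_union_Ioc_eq_Ioc hax hxy, VectorMeasure.of_union
    (Ioc_disjoint_Ioc_of_le le_rfl) measurableSet_Ioc measurableSet_Ioc]
  ring

theorem signedMeasure_Ioo_sub (μ : SignedMeasure ℝ) {a x y : ℝ} (hax : a ≤ x) (hxy : x < y) :
    μ (Ioo a y) - μ (Ioc a x) = μ (Ioo x y) := by
  rw [← Ioc_union_Ioo_eq_Ioo hax hxy, VectorMeasure.of_union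
    (by rw [Set.disjoint_left]; exact fun z h1 h2 => h1.2.not_gt h2.1)
    measurableSet_Ioc measurableSet_Ioo]
  ring

theorem signedMeasure_singleton_eq (μ : SignedMeasure ℝ) {a x : ℝ} (hax : a < x) :
    μ (Ioc a x) - μ (Ioo a x) = μ {x} := by
  rw [← Ioo_union_right hax, VectorMeasure.of_union
    (by simp) measurableSet_Ioo (measurableSet_singleton x)]
  ring

/-- On (x, x + r) the deviation of u is bounded by the variation of μ on this open interval, which
tends to 0 with r. The case x = a is allowed, for the boundary values. -/
theorem hasRightTrace_of_ae_eq {a b c : ℝ} {u : ℝ → ℝ} {μ : SignedMeasure ℝ}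
    (hu : ∀ᵐ x ∂volume.restrict (Ioo a b), u x = c + μ (Ioc a x)) {x : ℝ} (hax : a ≤ x)
    (hxb : x < b) : HasRightTrace u x (c + μ (Ioc a x)) := by
  refine tendsto_setAverage_zero (C := fun r => μ.totalVariation.real (Ioo x (x + r)))
    (by simp) (fun r => measureReal_nonneg) (tendsto_measure_Ioo_right _ x) ?_
  filter_upwards [Ioo_mem_nhdsGT (show (0 : ℝ) < b - x by linarith)] with r hr
  have h1 := ae_mono (Measure.restrict_mono (Ioo_subset_Ioo hax (by linarith [hr.2]) :
    Ioo x (x + r) ⊆ Ioo a b) le_rfl) hu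
  filter_upwards [h1, ae_restrict_mem measurableSet_Ioo] with y hy hy'
  rw [abs_abs, hy, add_sub_add_left_eq_sub, signedMeasure_Ioc_sub μ hax hy'.1.le]
  exact (abs_signedMeasure_le μ measurableSet_Ioc).trans
    (measureReal_mono (Ioc_subset_Ioo_right hy'.2))

theorem hasLeftTrace_of_ae_eq {a b c : ℝ} {u : ℝ → ℝ} {μ : SignedMeasure ℝ}
    (hu : ∀ᵐ x ∂volume.restrict (Ioo a b), u x = c + μ (Ioc a x)) {x : ℝ} (hax : a < x)
    (hxb : x ≤ b) : HasLeftTrace u x (c + μ (Ioo a x)) := by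
  refine tendsto_setAverage_zero (C := fun r => μ.totalVariation.real (Ioo (x - r) x))
    (by simp) (fun r => measureReal_nonneg) (tendsto_measure_Ioo_left _ x) ?_
  filter_upwards [Ioo_mem_nhdsGT (show (0 : ℝ) < x - a by linarith)] with r hr
  have h1 := ae_mono (Measure.restrict_mono (Ioo_subset_Ioo (by linarith [hr.2]) hxb :
    Ioo (x - r) x ⊆ Ioo a b) le_rfl) hu
  filter_upwards [h1, ae_restrict_mem measurableSet_Ioo] with y hy hy'
  rw [abs_abs, hy, add_sub_add_left_eq_sub, abs_sub_comm,
    signedMeasure_Ioo_sub μ (by linarith [hy'.1, hr.2]) hy'.2]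
  exact (abs_signedMeasure_le μ measurableSet_Ioo).trans
    (measureReal_mono (Ioo_subset_Ioo_left hy'.1.le))

theorem eq_of_tendsto_setAverage {s : ℝ → Set ℝ} {u : ℝ → ℝ} {p q : ℝ}
    (hs : ∀ᶠ r in 𝓝[>] (0 : ℝ), volume (s r) ≠ 0 ∧ volume (s r) ≠ ⊤ ∧ IntegrableOn u (s r))
    (hp : Tendsto (fun r => ⨍ y in s r, |u y - p|) (𝓝[>] 0) (𝓝 0))
    (hq : Tendsto (fun r => ⨍ y in s r, |u y - q|) (𝓝[>] 0) (𝓝 0)) : p = q := by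
  have h := hp.add hq
  rw [add_zero] at h
  have hle : |p - q| ≤ 0 := by
    refine ge_of_tendsto h ?_
    filter_upwards [hs] with r hr
    have hfin : IsFiniteMeasure (volume.restrict (s r)) := ⟨by simpa using hr.2.1.lt_top⟩
    have hne : NeZero (volume.restrict (s r)) := ⟨by
      rw [Ne, Measure.restrict_eq_zero]; exact hr.1⟩
    have i1 : Integrable (fun y => |u y - p|) (volume.restrict (s r)) :=
      (hr.2.2.sub (integrable_const p)).abs
    have i2 : Integrable (fun y => |u y - q|) (volume.restrict (s r)) :=
      (hr.2.2.sub (integrable_const q)).abs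
    calc |p - q| = ⨍ _ in s r, |p - q| := (average_const _ _).symm
      _ ≤ ⨍ y in s r, (|u y - p| + |u y - q|) := by
          rw [average_eq, average_eq, smul_eq_mul, smul_eq_mul]
          refine mul_le_mul_of_nonneg_left ?_ (inv_nonneg.2 measureReal_nonneg)
          refine integral_mono (integrable_const _) (i1.add i2) fun y => ?_
          rw [abs_sub_comm (u y) p]
          exact abs_sub_le p (u y) q
      _ = _ := by
          rw [average_eq, average_eq, average_eq, integral_add i1 i2, smul_add]
  exact sub_eq_zero.1 (abs_nonpos_iff.1 hle)

theorem HasRightTrace.unique {a b x p q : ℝ} {u : ℝ → ℝ} (hu : IntegrableOn u (Ioo a b))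
    (hax : a ≤ x) (hxb : x < b) (hp : HasRightTrace u x p) (hq : HasRightTrace u x q) : p = q := by
  refine eq_of_tendsto_setAverage ?_ hp hq
  filter_upwards [Ioo_mem_nhdsGT (show (0 : ℝ) < b - x by linarith)] with r hr
  refine ⟨by simpa using hr.1, by simp, hu.mono_set (Ioo_subset_Ioo hax (by linarith [hr.2]))⟩

theorem HasLeftTrace.unique {a b x p q : ℝ} {u : ℝ → ℝ} (hu : IntegrableOn u (Ioo a b))
    (hax : a < x) (hxb : x ≤ b) (hp : HasLeftTrace u x p) (hq : HasLeftTrace u x q) : p = q := by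
  refine eq_of_tendsto_setAverage ?_ hp hq
  filter_upwards [Ioo_mem_nhdsGT (show (0 : ℝ) < x - a by linarith)] with r hr
  refine ⟨by simpa using hr.1, by simp, hu.mono_set (Ioo_subset_Ioo (by linarith [hr.2]) hxb)⟩

theorem jump_eq {a b c : ℝ} {u : ℝ → ℝ} {μ : SignedMeasure ℝ} (hi : IntegrableOn u (Ioo a b))
    (hu : ∀ᵐ x ∂volume.restrict (Ioo a b), u x = c + μ (Ioc a x)) {x : ℝ} (hx : x ∈ Ioo a b) :
    rightTrace u x - leftTrace u x = μ {x} := by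
  have hr := hasRightTrace_of_ae_eq hu hx.1.le hx.2
  have hl := hasLeftTrace_of_ae_eq hu hx.1 hx.2.le
  have hr' : rightTrace u x = c + μ (Ioc a x) :=
    HasRightTrace.unique hi hx.1.le hx.2 (Classical.epsilon_spec ⟨_, hr⟩) hr
  have hl' : leftTrace u x = c + μ (Ioo a x) :=
    HasLeftTrace.unique hi hx.1 hx.2.le (Classical.epsilon_spec ⟨_, hl⟩) hl
  rw [hr', hl', add_sub_add_left_eq_sub, signedMeasure_singleton_eq μ hx.1]

theorem jumpSet_eq {a b c : ℝ} {u : ℝ → ℝ} {μ : SignedMeasure ℝ} (hi : IntegrableOn u (Ioo a b))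
    (hu : ∀ᵐ x ∂volume.restrict (Ioo a b), u x = c + μ (Ioc a x)) :
    jumpSet a b u = {x | x ∈ Ioo a b ∧ μ {x} ≠ 0} := by
  ext x
  refine and_congr_right fun hx => ?_
  have hr := hasRightTrace_of_ae_eq hu hx.1.le hx.2
  have hl := hasLeftTrace_of_ae_eq hu hx.1 hx.2.le
  rw [← signedMeasure_singleton_eq μ hx.1, sub_ne_zero]
  constructor
  · rintro ⟨p, q, hpq, hp, hq⟩ heq
    refine hpq ?_
    rw [HasLeftTrace.unique hi hx.1 hx.2.le hp hl, HasRightTrace.unique hi hx.1.le hx.2 hq hr, heq]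
  · intro hne
    exact ⟨_, _, fun h => hne (add_left_cancel h).symm, hl, hr⟩

theorem countable_atoms (μ : SignedMeasure ℝ) : {x : ℝ | μ {x} ≠ 0}.Countable := by
  have h := Measure.countable_meas_pos_of_disjoint_iUnion (μ := μ.totalVariation)
    (As := fun x : ℝ => {x}) (fun x => measurableSet_singleton x)
    (fun x y hxy => by simpa [Function.onFun] using hxy)
  refine h.mono fun x hx => ?_
  simp only [mem_ofPred_eq]
  rw [totalVariation_singleton]
  simpa using hx

/-! ### Discretising the energy -/

/-- The measure whose mass on the whole interval is `TV_K`: diffuse variation outside the jump set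
`J` plus the costs of the jumps. -/
noncomputable def costMeasure (a b : ℝ) (μ : SignedMeasure ℝ) (J : Set ℝ) : Measure ℝ :=
  μ.totalVariation.restrict (Ioo a b \ J) +
    Measure.sum fun z : J => ENNReal.ofReal ((fun ρ : ℝ => ρ / (1 + ρ)) |μ {(z : ℝ)}|) •
      Measure.dirac (z : ℝ)

theorem costMeasure_apply {a b : ℝ} (μ : SignedMeasure ℝ) (J : Set ℝ) {s : Set ℝ}
    (hs : MeasurableSet s) : costMeasure a b μ J s =
      μ.totalVariation (s ∩ (Ioo a b \ J)) + ∑' z : J,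
        ENNReal.ofReal ((fun ρ : ℝ => ρ / (1 + ρ)) |μ {(z : ℝ)}|) * s.indicator 1 (z : ℝ) := by
  rw [costMeasure, Measure.add_apply, Measure.restrict_apply hs, Measure.sum_apply _ hs]
  congr 1
  refine tsum_congr fun z => ?_
  rw [Measure.smul_apply, Measure.dirac_apply' _ hs, smul_eq_mul]

theorem costMeasure_Ioo_le {a b : ℝ} {u : ℝ → ℝ} {c : ℝ} (hi : IntegrableOn u (Ioo a b))
    (hu : ∀ᵐ x ∂volume.restrict (Ioo a b), u x = c + distribDeriv a b u (Ioc a x)) :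
    costMeasure a b (distribDeriv a b u) (jumpSet a b u) (Ioo a b) ≤
      TV (fun ρ => ρ / (1 + ρ)) a b u := by
  rw [costMeasure_apply _ _ measurableSet_Ioo, TV]
  refine add_le_add (measure_mono inter_subset_right) (ENNReal.tsum_le_tsum fun z => ?_)
  rw [jump_eq hi hu z.2.1, indicator_of_mem z.2.1, Pi.one_apply, mul_one]

/-- The jump cost of the increment of a function over `(x, y]` is bounded by its `TV_K` there. -/
theorem jumpCost_le_costMeasure {a b : ℝ} {μ : SignedMeasure ℝ} {J : Set ℝ}
    (hJ : J = {x | x ∈ Ioo a b ∧ μ {x} ≠ 0}) {x y : ℝ} (hax : a ≤ x) (hyb : y < b) :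
    ENNReal.ofReal ((fun ρ : ℝ => ρ / (1 + ρ)) |μ (Ioc x y)|) ≤ costMeasure a b μ J (Ioc x y) := by
  have hJc : J.Countable := by rw [hJ]; exact (countable_atoms μ).mono fun x hx => hx.2
  have hJm : MeasurableSet J := hJc.measurableSet
  have hsub : Ioc x y ⊆ Ioo a b := fun z hz => ⟨hax.trans_lt hz.1, hz.2.trans_lt hyb⟩
  obtain ⟨R, hR⟩ : ∃ R, R = μ.totalVariation.real (Ioc x y) := ⟨_, rfl⟩
  have hR0 : 0 ≤ R := by rw [hR]; exact measureReal_nonneg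
  have hRtv : μ.totalVariation (Ioc x y) = ENNReal.ofReal R := by
    rw [hR, measureReal_def, ENNReal.ofReal_toReal (measure_ne_top _ _)]
  calc ENNReal.ofReal ((fun ρ : ℝ => ρ / (1 + ρ)) |μ (Ioc x y)|)
      ≤ ENNReal.ofReal ((fun ρ : ℝ => ρ / (1 + ρ)) R) := by
        refine ENNReal.ofReal_le_ofReal (monotoneOn_div_one_add (mem_Ici.2 (abs_nonneg _)) hR0 ?_)
        rw [hR]
        exact abs_signedMeasure_le μ measurableSet_Ioc
    -- K(R) spreads the common factor 1/(1 + R) over the variation. It is at most 1 on the diffuse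
    -- part, and at an atom of size s ≤ R it is at most 1/(1 + s), giving K(s).
    _ = μ.totalVariation (Ioc x y) * ENNReal.ofReal (1 / (1 + R)) := by
        rw [hRtv, ← ENNReal.ofReal_mul hR0, mul_one_div]
    _ = μ.totalVariation (Ioc x y \ J) * ENNReal.ofReal (1 / (1 + R)) +
        (∑' z : J, ENNReal.ofReal |μ {(z : ℝ)}| * (Ioc x y).indicator 1 (z : ℝ)) *
          ENNReal.ofReal (1 / (1 + R)) := by
        rw [← add_mul, ← measure_sdiff_add_inter (Ioc x y) hJm]
        congr 2
        have e : Ioc x y ∩ J = ⋃ z ∈ J, {z} ∩ Ioc x y := by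
          ext w; simp only [mem_inter_iff, mem_iUnion, mem_singleton_iff, exists_prop]; grind
        rw [e, measure_biUnion hJc]
        · refine tsum_congr fun z => ?_
          by_cases hz : (z : ℝ) ∈ Ioc x y
          · rw [indicator_of_mem hz, inter_eq_left.2 (singleton_subset_iff.2 hz),
              totalVariation_singleton]
            simp
          · rw [indicator_of_notMem hz, singleton_inter_eq_empty.2 hz]
            simp
        · intro z _ w _ hzw
          exact (disjoint_singleton.2 hzw).mono inter_subset_left inter_subset_left
        · exact fun z _ => (measurableSet_singleton z).inter measurableSet_Ioc
    _ ≤ costMeasure a b μ J (Ioc x y) := by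
        rw [costMeasure_apply _ _ measurableSet_Ioc, ← ENNReal.tsum_mul_right]
        refine add_le_add ?_ (ENNReal.tsum_le_tsum fun z => ?_)
        · refine (mul_le_of_le_one_right' ?_).trans (measure_mono fun z hz => ⟨hz.1, hsub hz.1, hz.2⟩)
          rw [← ENNReal.ofReal_one]
          refine ENNReal.ofReal_le_ofReal ?_
          rw [div_le_one (by positivity)]
          linarith
        · by_cases hz : (z : ℝ) ∈ Ioc x y
          · rw [indicator_of_mem hz, Pi.one_apply, mul_one, mul_one,
              ← ENNReal.ofReal_mul (abs_nonneg _), mul_one_div]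
            refine ENNReal.ofReal_le_ofReal ?_
            refine div_le_div_of_nonneg_left (abs_nonneg _) (by positivity) ?_
            have h1 := abs_signedMeasure_le μ (measurableSet_singleton (z : ℝ))
            have h2 : μ.totalVariation.real {(z : ℝ)} ≤ R :=
              hR ▸ measureReal_mono (singleton_subset_iff.2 hz)
            linarith
          · rw [indicator_of_notMem hz]
            simp

theorem IsBV.hasDistribDeriv {a b : ℝ} {u : ℝ → ℝ} (hu : IsBV a b u) :
    HasDistribDeriv a b u (distribDeriv a b u) := by
  unfold distribDeriv
  rw [dif_pos hu.2]
  exact hu.2.choose_spec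

theorem exists_le_cell_mean {p h : ℝ} (hh : 0 < h) {f : ℝ → ℝ≥0∞}
    (hf : AEMeasurable f (volume.restrict (Ioo p (p + h)))) {Q : ℝ → Prop}
    (hQ : ∀ᵐ x ∂volume.restrict (Ioo p (p + h)), Q x) :
    ∃ ξ ∈ Ioo p (p + h), Q ξ ∧ ENNReal.ofReal h * f ξ ≤ ∫⁻ x in Ioo p (p + h), f x := by
  have hv : volume.restrict (Ioo p (p + h)) univ = ENNReal.ofReal h := by simp
  have hne : volume.restrict (Ioo p (p + h)) ≠ 0 := fun h0 => by
    rw [h0] at hv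
    simp only [Measure.coe_zero, Pi.zero_apply] at hv
    exact (ENNReal.ofReal_pos.2 hh).ne hv
  have hQ' : ∀ᵐ x ∂volume.restrict (Ioo p (p + h)), x ∈ Ioo p (p + h) ∧ Q x :=
    (ae_restrict_mem measurableSet_Ioo).and hQ
  obtain ⟨ξ, hξ, hξ'⟩ := exists_notMem_null_le_laverage hne hf (ae_iff.1 hQ')
  have hξ : ξ ∈ Ioo p (p + h) ∧ Q ξ := not_not.1 hξ
  refine ⟨ξ, hξ.1, hξ.2, ?_⟩
  rw [laverage_eq, hv] at hξ'
  rw [mul_comm]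
  exact ENNReal.mul_le_of_le_div hξ'

theorem aemeasurable_fidelity {a b : ℝ} {u : ℝ → ℝ} (hu : IntegrableOn u (Ioo a b)) :
    AEMeasurable (fun x => ENNReal.ofReal (|u x - x| ^ 2)) (volume.restrict (Ioo a b)) := by
  have h := hu.aestronglyMeasurable.aemeasurable
  fun_prop

/-- The energy of a function of bounded variation bounds the discrete energy of its samples at
suitable points of the cells of a uniform grid. -/
theorem exists_samples {a h lam c : ℝ} {n : ℕ} (hh : 0 < h) (hlam : 0 < lam) {u : ℝ → ℝ}
    (hi : IntegrableOn u (Ioo a (a + (n + 1) * h)))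
    (hu : ∀ᵐ x ∂volume.restrict (Ioo a (a + (n + 1) * h)),
      u x = c + distribDeriv a (a + (n + 1) * h) u (Ioc a x)) :
    ∃ y ξ : Fin (n + 1) → ℝ, (∀ i : Fin (n + 1), ξ i ∈ Ioo (a + i * h) (a + i * h + h)) ∧
      (∀ i, y i = c + distribDeriv a (a + (n + 1) * h) u (Ioc a (ξ i))) ∧
      ENNReal.ofReal (∑ i : Fin n, (fun ρ : ℝ => ρ / (1 + ρ)) |y i.castSucc - y i.succ| +
          lam / 2 * (h * ∑ i, (y i - ξ i) ^ 2)) ≤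
        energy (fun ρ => ρ / (1 + ρ)) (fun x => x) lam a (a + (n + 1) * h) u := by
  obtain ⟨b, hb⟩ : ∃ b, b = a + (n + 1) * h := ⟨_, rfl⟩
  rw [← hb] at hi hu ⊢
  set μ := distribDeriv a b u
  let f : ℝ → ℝ≥0∞ := fun x => ENNReal.ofReal (|u x - x| ^ 2)
  have hgrid : ∀ i : Fin (n + 1), a ≤ a + i * h ∧ a + i * h + h ≤ b := by
    intro i
    have h1 : (i : ℝ) + 1 ≤ n + 1 := by exact_mod_cast i.2
    have h2 : 0 ≤ (i : ℝ) * h := by positivity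
    have h3 := mul_le_mul_of_nonneg_right h1 hh.le
    constructor
    · linarith
    · rw [hb]; linarith
  have hcell : ∀ i : Fin (n + 1), Ioo (a + i * h) (a + i * h + h) ⊆ Ioo a b := fun i =>
    Ioo_subset_Ioo (hgrid i).1 (hgrid i).2
  have hlt : ∀ i j : Fin (n + 1), i < j → a + i * h + h ≤ a + j * h := by
    intro i j hij
    have h1 : (i : ℝ) + 1 ≤ j := by exact_mod_cast hij
    have h2 := mul_le_mul_of_nonneg_right h1 hh.le
    linarith
  have hex : ∀ i : Fin (n + 1), ∃ ξ ∈ Ioo (a + i * h) (a + i * h + h),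
      u ξ = c + μ (Ioc a ξ) ∧
      ENNReal.ofReal h * f ξ ≤ ∫⁻ x in Ioo (a + i * h) (a + i * h + h), f x := fun i =>
    exists_le_cell_mean hh
      ((aemeasurable_fidelity hi).mono_measure (Measure.restrict_mono (hcell i) le_rfl))
      (ae_mono (Measure.restrict_mono (hcell i) le_rfl) hu)
  choose ξ hξ hξu hξf using hex
  have hξlt : ∀ i j, i < j → ξ i < ξ j := fun i j hij =>
    (hξ i).2.trans_le ((hlt i j hij).trans (hξ j).1.le)
  refine ⟨fun i => u (ξ i), ξ, hξ, hξu, ?_⟩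
  have hjump : ∑ i : Fin n, ENNReal.ofReal ((fun ρ : ℝ => ρ / (1 + ρ))
      |u (ξ i.castSucc) - u (ξ i.succ)|) ≤ TV (fun ρ => ρ / (1 + ρ)) a b u := by
    calc _ ≤ ∑ i : Fin n, costMeasure a b μ (jumpSet a b u) (Ioc (ξ i.castSucc) (ξ i.succ)) := by
          refine Finset.sum_le_sum fun i _ => ?_
          have h1 := (hcell _ (hξ i.castSucc)).1.le
          rw [hξu, hξu, add_sub_add_left_eq_sub, abs_sub_comm, signedMeasure_Ioc_sub μ h1
            (hξlt _ _ i.castSucc_lt_succ).le]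
          exact jumpCost_le_costMeasure (jumpSet_eq hi hu) h1 (hcell _ (hξ i.succ)).2
      _ = costMeasure a b μ (jumpSet a b u)
            (⋃ i ∈ (Finset.univ : Finset (Fin n)), Ioc (ξ i.castSucc) (ξ i.succ)) := by
          rw [measure_biUnion_finset]
          · intro i _ j _ hij
            rcases lt_or_gt_of_ne hij with h | h
            · have h1 : ξ i.succ ≤ ξ j.castSucc := by
                rcases (Fin.succ_le_castSucc_iff.2 h).eq_or_lt with h | h
                · rw [h]
                · exact (hξlt _ _ h).le
              exact Ioc_disjoint_Ioc_of_le h1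
            · have h1 : ξ j.succ ≤ ξ i.castSucc := by
                rcases (Fin.succ_le_castSucc_iff.2 h).eq_or_lt with h | h
                · rw [h]
                · exact (hξlt _ _ h).le
              exact (Ioc_disjoint_Ioc_of_le h1).symm
          · exact fun i _ => measurableSet_Ioc
      _ ≤ costMeasure a b μ (jumpSet a b u) (Ioo a b) := by
          refine measure_mono (iUnion₂_subset fun i _ x hx => ?_)
          exact ⟨(hcell _ (hξ i.castSucc)).1.trans hx.1, hx.2.trans_lt (hcell _ (hξ i.succ)).2⟩
      _ ≤ _ := costMeasure_Ioo_le hi hu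
  have hfid : ENNReal.ofReal h * ∑ i, f (ξ i) ≤ ∫⁻ x in Ioo a b, f x := by
    rw [Finset.mul_sum]
    calc _ ≤ ∑ i : Fin (n + 1), ∫⁻ x in Ioo (a + i * h) (a + i * h + h), f x :=
          Finset.sum_le_sum fun i _ => hξf i
      _ = ∫⁻ x in ⋃ i ∈ (Finset.univ : Finset (Fin (n + 1))),
            Ioo (a + i * h) (a + i * h + h), f x := by
          rw [lintegral_biUnion_finset]
          · intro i _ j _ hij
            simp only [Function.onFun]
            rw [Set.disjoint_left]
            intro x hx hx'
            rcases lt_or_gt_of_ne hij with h | h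
            · linarith [hlt i j h, hx.2, hx'.1]
            · linarith [hlt j i h, hx.1, hx'.2]
          · exact fun i _ => measurableSet_Ioo
      _ ≤ _ := lintegral_mono_set (iUnion₂_subset fun i _ => hcell i)
  have hK : ∀ x : ℝ, 0 ≤ (fun ρ : ℝ => ρ / (1 + ρ)) |x| := fun x => by positivity
  rw [ENNReal.ofReal_add (Finset.sum_nonneg fun i _ => hK _) (by positivity),
    ENNReal.ofReal_sum_of_nonneg fun i _ => hK _, ENNReal.ofReal_mul (by positivity),
    ENNReal.ofReal_mul hh.le, ENNReal.ofReal_sum_of_nonneg fun i _ => by positivity]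
  refine add_le_add hjump (mul_le_mul_right ?_ _)
  simp only [← sq_abs (u _ - _)]
  exact hfid

/-- The uncovered heights e₁, e₂ are tied to sample points in the first and last cells, so that
prescribed traces can force them to vanish as the mesh shrinks. -/
theorem exists_increments {a b lam c : ℝ} (hab : a < b) (hlam : 0 < lam) {u : ℝ → ℝ}
    (hi : IntegrableOn u (Ioo a b))
    (hu : ∀ᵐ x ∂volume.restrict (Ioo a b), u x = c + distribDeriv a b u (Ioc a x))
    (hE : energy (fun ρ => ρ / (1 + ρ)) (fun x => x) lam a b u ≠ ⊤) (n : ℕ) {h : ℝ}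
    (hh : h = (b - a) / (n + 1)) :
    ∃ (ρ : Fin n → ℝ) (e₁ e₂ : ℝ), (∀ i, 0 ≤ ρ i) ∧ 0 ≤ e₁ ∧ 0 ≤ e₂ ∧
      (∃ ξ ∈ Ioo a (a + h), e₁ ≤ |c + distribDeriv a b u (Ioc a ξ) - a|) ∧
      (∃ ξ ∈ Ioo (b - h) b, e₂ ≤ |c + distribDeriv a b u (Ioc a ξ) - b|) ∧
      e₁ + e₂ + ∑ i, ρ i = b - a ∧
      ∑ i, stepCost lam (ρ i) + lam / 6 * (e₁ ^ 3 + e₂ ^ 3) - lam * (b - a) ^ 2 * h ≤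
        (energy (fun ρ => ρ / (1 + ρ)) (fun x => x) lam a b u).toReal := by
  have hL : (n + 1) * h = b - a := by rw [hh]; field_simp
  have hb : b = a + (n + 1) * h := by rw [hL]; ring
  have hh0 : 0 < h := by rw [hh]; exact div_pos (sub_pos.2 hab) (by positivity)
  rw [← hL]
  subst hb
  obtain ⟨y, ξ, hξ, hy, hle⟩ := exists_samples hh0 hlam hi hu
  obtain ⟨ρ, e₁, e₂, hρ, he₁, he₂, h1, h2, h3, h4⟩ := discrete_energy_ge hh0 hlam y ξ
    (fun i => (hξ i).1.le) (fun i => (hξ i).2.le)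
  refine ⟨ρ, e₁, e₂, hρ, he₁, he₂, ⟨ξ 0, ?_, ?_⟩, ⟨ξ (Fin.last n), ?_, ?_⟩, h3,
    h4.trans ((ENNReal.ofReal_le_iff_le_toReal hE).1 hle)⟩
  · simpa using hξ 0
  · rw [← hy]; exact h1
  · have := hξ (Fin.last n)
    rw [Fin.val_last] at this
    constructor <;> linarith [this.1, this.2]
  · rw [← hy]; exact h2

theorem tendsto_mesh (L : ℝ) : Tendsto (fun n : ℕ => L / ((n : ℝ) + 1)) atTop (𝓝 0) := by
  simpa [div_eq_mul_inv] using (tendsto_one_div_add_atTop_nhds_zero_nat (𝕜 := ℝ)).const_mul L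

/-! ### Lower bounds in the limit of vanishing mesh -/

/-- A lower bound for the energies of finite monotone steps is a lower bound for the energy of all
functions of bounded variation. -/
theorem le_energy_of_forall_sum {a b lam m : ℝ} (hab : a < b) (hlam : 0 < lam)
    (hm : ∀ (n : ℕ) (ρ : Fin n → ℝ), (∀ i, 0 ≤ ρ i) → ∑ i, ρ i ≤ b - a →
      m ≤ ∑ i, stepCost lam (ρ i) + lam * (b - a - ∑ i, ρ i) ^ 3 / 24)
    {u : ℝ → ℝ} (hu : IsBV a b u) :
    ENNReal.ofReal m ≤ energy (fun ρ => ρ / (1 + ρ)) (fun x => x) lam a b u := by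
  by_cases hE : energy (fun ρ => ρ / (1 + ρ)) (fun x => x) lam a b u = ⊤
  · rw [hE]; exact le_top
  obtain ⟨c, hc⟩ := ae_eq_primitive hab hu.1 hu.hasDistribDeriv
  rw [ENNReal.ofReal_le_iff_le_toReal hE]
  have hlim : Tendsto (fun n : ℕ => m - lam * (b - a) ^ 2 * ((b - a) / ((n : ℝ) + 1))) atTop
      (𝓝 m) := by
    simpa using tendsto_const_nhds.sub ((tendsto_mesh (b - a)).const_mul (lam * (b - a) ^ 2))
  refine le_of_tendsto' hlim fun n => ?_
  obtain ⟨ρ, e₁, e₂, hρ, he₁, he₂, -, -, hs, hle⟩ := exists_increments hab hlam hu.1 hc hE n rfl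
  have h1 := hm n ρ hρ (by linarith)
  rw [show b - a - ∑ i, ρ i = e₁ + e₂ by linarith] at h1
  -- An uncovered height is cheapest when split equally between the two ends, which gives the
  -- constant 1/24 = (1/6)(1/4).
  have h2 : (e₁ + e₂) ^ 3 / 4 ≤ e₁ ^ 3 + e₂ ^ 3 := by
    nlinarith [mul_nonneg (add_nonneg he₁ he₂) (sq_nonneg (e₁ - e₂))]
  have h3 := mul_le_mul_of_nonneg_left h2 (by positivity : 0 ≤ lam / 6)
  linarith

theorem le_energy_of_forall_sum_of_boundary {a b lam m : ℝ} (hab : a < b) (hlam : 0 < lam)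
    (hm : ∀ (n : ℕ) (ρ : Fin n → ℝ), (∀ i, 0 ≤ ρ i) → ∑ i, ρ i = b - a →
      m ≤ ∑ i, stepCost lam (ρ i))
    {u : ℝ → ℝ} (hu : IsBV a b u) (hbd : HasBoundaryValues (fun x => x) a b u) :
    ENNReal.ofReal m ≤ energy (fun ρ => ρ / (1 + ρ)) (fun x => x) lam a b u := by
  by_cases hE : energy (fun ρ => ρ / (1 + ρ)) (fun x => x) lam a b u = ⊤
  · rw [hE]; exact le_top
  obtain ⟨c, hc⟩ := ae_eq_primitive hab hu.1 hu.hasDistribDeriv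
  have hca : a = c := by
    have h1 := hasRightTrace_of_ae_eq hc le_rfl hab
    simp only [Ioc_self, VectorMeasure.empty, add_zero] at h1
    exact HasRightTrace.unique hu.1 le_rfl hab hbd.1 h1
  have hcb : b = c + distribDeriv a b u (Ioo a b) :=
    HasLeftTrace.unique hu.1 hab le_rfl hbd.2 (hasLeftTrace_of_ae_eq hc hab le_rfl)
  rw [ENNReal.ofReal_le_iff_le_toReal hE]
  set tv := (distribDeriv a b u).totalVariation
  have hmesh : Tendsto (fun n : ℕ => (b - a) / ((n : ℝ) + 1)) atTop (𝓝[>] 0) :=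
    tendsto_nhdsWithin_iff.2 ⟨tendsto_mesh _, Eventually.of_forall fun n =>
      div_pos (sub_pos.2 hab) (by positivity)⟩
  have hlim : Tendsto (fun n : ℕ => m - tv.real (Ioo a (a + (b - a) / ((n : ℝ) + 1))) -
      tv.real (Ioo (b - (b - a) / ((n : ℝ) + 1)) b) -
      lam * (b - a) ^ 2 * ((b - a) / ((n : ℝ) + 1))) atTop (𝓝 m) := by
    simpa using ((tendsto_const_nhds.sub ((tendsto_measure_Ioo_right tv a).comp hmesh)).sub
      ((tendsto_measure_Ioo_left tv b).comp hmesh)).sub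
        ((tendsto_mesh (b - a)).const_mul (lam * (b - a) ^ 2))
  refine le_of_tendsto' hlim fun n => ?_
  obtain ⟨ρ, e₁, e₂, hρ, he₁, he₂, ⟨ξ, hξ, h1⟩, ⟨ζ, hζ, h2⟩, hs, hle⟩ :=
    exists_increments hab hlam hu.1 hc hE n rfl
  have hn : (b - a) / ((n : ℝ) + 1) ≤ b - a := div_le_self (by linarith) (by
    have : (0 : ℝ) ≤ n := n.cast_nonneg
    linarith)
  have h1' : e₁ ≤ tv.real (Ioo a (a + (b - a) / ((n : ℝ) + 1))) := by
    refine h1.trans ?_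
    rw [← hca, add_sub_cancel_left]
    exact (abs_signedMeasure_le _ measurableSet_Ioc).trans
      (measureReal_mono (Ioc_subset_Ioo_right hξ.2))
  have h2' : e₂ ≤ tv.real (Ioo (b - (b - a) / ((n : ℝ) + 1)) b) := by
    refine h2.trans ?_
    have e : c + distribDeriv a b u (Ioc a ζ) - b = -distribDeriv a b u (Ioo ζ b) := by
      rw [← signedMeasure_Ioo_sub (distribDeriv a b u) (by linarith [hζ.1] : a ≤ ζ) hζ.2]
      linarith
    rw [e, abs_neg]
    exact (abs_signedMeasure_le _ measurableSet_Ioo).trans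
      (measureReal_mono (Ioo_subset_Ioo_left hζ.1.le))
  -- The end gaps are counted as two further jumps, so that the heights add up to b - a exactly;
  -- their extra jump cost is at most e₁ + e₂, which tends to 0.
  have h3 := hm (n + 2) (Fin.cons e₁ (Fin.cons e₂ ρ : Fin (n + 1) → ℝ) : Fin (n + 2) → ℝ)
    (fun i => by
      refine Fin.cases he₁ (fun i => ?_) i
      refine Fin.cases he₂ (fun i => ?_) i
      exact hρ i)
    (by
      rw [Fin.sum_univ_succ, Fin.sum_univ_succ]
      simp only [Fin.cons_zero, Fin.cons_succ]
      linarith)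
  rw [Fin.sum_univ_succ, Fin.sum_univ_succ] at h3
  simp only [Fin.cons_zero, Fin.cons_succ] at h3
  have hcost : ∀ e : ℝ, 0 ≤ e → stepCost lam e ≤ e + lam / 6 * e ^ 3 := by
    intro e he
    have h4 : e / (1 + e) ≤ e := div_le_self he (by linarith)
    have h5 : 0 ≤ lam * e ^ 3 := by positivity
    unfold stepCost
    linarith
  linarith [hcost e₁ he₁, hcost e₂ he₂]

/-! ### Energies of the explicit step functions -/

theorem toENNReal_eq_of_real_eq {P N V : Measure ℝ} [IsFiniteMeasure P] [IsFiniteMeasure N]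
    [IsFiniteMeasure V] {s : Set ℝ} (h : P.real s - N.real s = V.real s) :
    P s = N s + V s := by
  rw [← ENNReal.toReal_eq_toReal_iff' (measure_ne_top _ _) (by finiteness),
    ENNReal.toReal_add (measure_ne_top _ _) (measure_ne_top _ _)]
  simp only [measureReal_def] at h
  linarith

/-- A signed measure with the same distribution function as the positive measure `V` has no mass
where `V` has none. -/
theorem totalVariation_eq_zero_of_forall_Ioc {a b : ℝ} {μ : SignedMeasure ℝ} {V : Measure ℝ}
    [IsFiniteMeasure V] (h1 : ∀ x, a ≤ x → x < b → μ (Ioc a x) = V.real (Ioc a x))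
    (h2 : μ (Ioo a b) = V.real (Ioo a b)) {S : Set ℝ} (hS : MeasurableSet S)
    (hSab : S ⊆ Ioo a b) (hV : V S = 0) : μ.totalVariation S = 0 := by
  have key : μ.toJordanDecomposition.posPart.restrict (Ioo a b) =
      (μ.toJordanDecomposition.negPart + V).restrict (Ioo a b) := by
    refine Measure.ext_of_Iic _ _ fun x => ?_
    rw [Measure.restrict_apply measurableSet_Iic, Measure.restrict_apply measurableSet_Iic,
      Measure.add_apply]
    rcases lt_or_ge x a with hxa | hax
    · have e : Iic x ∩ Ioo a b = ∅ := by
        ext z; simp only [mem_inter_iff, mem_Iic, mem_Ioo, mem_empty_iff_false]; grind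
      simp [e]
    · rcases lt_or_ge x b with hxb | hbx
      · have e : Iic x ∩ Ioo a b = Ioc a x := by
          ext z; simp only [mem_inter_iff, mem_Iic, mem_Ioo, mem_Ioc]; grind
        rw [e]
        have := h1 x hax hxb
        rw [signedMeasure_apply μ measurableSet_Ioc] at this
        exact toENNReal_eq_of_real_eq this
      · have e : Iic x ∩ Ioo a b = Ioo a b := by
          ext z; simp only [mem_inter_iff, mem_Iic, mem_Ioo]; grind
        rw [e]
        rw [signedMeasure_apply μ measurableSet_Ioo] at h2
        exact toENNReal_eq_of_real_eq h2
  have hT : ∀ T ⊆ S, MeasurableSet T →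
      μ.toJordanDecomposition.posPart T = μ.toJordanDecomposition.negPart T := by
    intro T hTS hT
    have h3 := congrArg (fun m => m T) key
    rw [Measure.restrict_apply hT, Measure.restrict_apply hT,
      inter_eq_left.2 (hTS.trans hSab), Measure.add_apply, measure_mono_null hTS hV, add_zero] at h3
    exact h3
  -- On subsets of S the positive and negative parts agree, yet they are mutually singular; hence
  -- both vanish on S.
  obtain ⟨s, hs, hp, hn⟩ := μ.toJordanDecomposition.mutuallySingular
  have hpS : μ.toJordanDecomposition.posPart S = 0 := by
    rw [← measure_inter_add_sdiff S hs, measure_mono_null inter_subset_right hp, zero_add,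
      hT _ sdiff_subset (hS.diff hs), measure_mono_null (fun x hx => hx.2) hn]
  rw [SignedMeasure.totalVariation, Measure.add_apply, ← hT S Subset.rfl hS, hpS, add_zero]

/-- The sum of point masses of size `r` at the points of `T`. -/
noncomputable def pointMasses (r : ℝ) (T : Finset ℝ) : Measure ℝ :=
  ∑ t ∈ T, ENNReal.ofReal r • Measure.dirac t

theorem pointMasses_apply (r : ℝ) (T : Finset ℝ) {s : Set ℝ} (hs : MeasurableSet s) :
    pointMasses r T s = ∑ t ∈ T, ENNReal.ofReal r * s.indicator 1 t := by
  simp only [pointMasses, Measure.finsetSum_apply, Measure.smul_apply, Measure.dirac_apply' _ hs,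
    smul_eq_mul]

instance isFiniteMeasure_pointMasses (r : ℝ) (T : Finset ℝ) :
    IsFiniteMeasure (pointMasses r T) := by
  refine ⟨?_⟩
  rw [pointMasses_apply r T MeasurableSet.univ]
  exact ENNReal.sum_lt_top.2 fun t _ => by simp

open Classical in
theorem pointMasses_real {r : ℝ} (hr : 0 ≤ r) (T : Finset ℝ) {s : Set ℝ} (hs : MeasurableSet s) :
    (pointMasses r T).real s = ∑ t ∈ T, if t ∈ s then r else 0 := by
  rw [measureReal_def, pointMasses_apply r T hs, ENNReal.toReal_sum fun t _ => by
    refine ENNReal.mul_ne_top ENNReal.ofReal_ne_top ?_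
    by_cases h : t ∈ s <;> simp [h]]
  refine Finset.sum_congr rfl fun t _ => ?_
  by_cases h : t ∈ s <;> simp [h, hr]

/-- The step function that starts with the value `c` and jumps up by `r` at the points of `T`. -/
noncomputable def stepFun (c r : ℝ) (T : Finset ℝ) (x : ℝ) : ℝ :=
  c + ∑ t ∈ T, if t ≤ x then r else 0

section stepFun

variable {a b c r : ℝ} {T : Finset ℝ}

theorem stepFun_eq (hr : 0 < r) (hT : ∀ t ∈ T, t ∈ Ioo a b) (x : ℝ) :
    stepFun c r T x = c + (pointMasses r T).toSignedMeasure (Ioc a x) := by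
  classical
  rw [Measure.toSignedMeasure_apply_measurable measurableSet_Ioc,
    pointMasses_real hr.le T measurableSet_Ioc, stepFun]
  congr 1
  refine Finset.sum_congr rfl fun t ht => ?_
  simp [(hT t ht).1]

theorem isBV_stepFun (hab : a < b) (hr : 0 < r) (hT : ∀ t ∈ T, t ∈ Ioo a b) :
    IsBV a b (stepFun c r T) := by
  have e : stepFun c r T = fun x => c + (pointMasses r T).toSignedMeasure (Ioc a x) :=
    funext (stepFun_eq hr hT)
  rw [e]
  exact ⟨integrableOn_primitive _ _, _, hasDistribDeriv_primitive hab _ _⟩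

/-- `distribDeriv` is some chosen derivative, so it is compared with the point masses through the
uniqueness of traces inside (a, b). An upper bound suffices, the lower bound being known for all of
BV. -/
theorem TV_stepFun_le (hab : a < b) (hr : 0 < r) (hT : ∀ t ∈ T, t ∈ Ioo a b) :
    TV (fun ρ => ρ / (1 + ρ)) a b (stepFun c r T) ≤ ENNReal.ofReal (T.card * (r / (1 + r))) := by
  classical
  set U := stepFun c r T
  have hBV : IsBV a b U := isBV_stepFun hab hr hT
  set V := pointMasses r T
  have hU : ∀ᵐ x ∂volume.restrict (Ioo a b), U x = c + V.toSignedMeasure (Ioc a x) :=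
    ae_of_all _ (stepFun_eq hr hT)
  obtain ⟨c', hU'⟩ := ae_eq_primitive hab hBV.1 hBV.hasDistribDeriv
  set μ := distribDeriv a b U
  have h1 : ∀ x, a ≤ x → x < b → c + V.toSignedMeasure (Ioc a x) = c' + μ (Ioc a x) :=
    fun x hax hxb => HasRightTrace.unique hBV.1 hax hxb (hasRightTrace_of_ae_eq hU hax hxb)
      (hasRightTrace_of_ae_eq hU' hax hxb)
  have hcc : c = c' := by simpa using h1 a le_rfl hab
  have h2 : c + V.toSignedMeasure (Ioo a b) = c' + μ (Ioo a b) :=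
    HasLeftTrace.unique hBV.1 hab le_rfl (hasLeftTrace_of_ae_eq hU hab le_rfl)
      (hasLeftTrace_of_ae_eq hU' hab le_rfl)
  have hsing : ∀ x, V.toSignedMeasure {x} = if x ∈ T then r else 0 := by
    intro x
    rw [Measure.toSignedMeasure_apply_measurable (measurableSet_singleton x),
      pointMasses_real hr.le T (measurableSet_singleton x)]
    simp
  have hJ : jumpSet a b U = ↑T := by
    rw [jumpSet_eq hBV.1 hU]
    ext x
    simp only [mem_ofPred_eq, Finset.mem_coe, hsing]
    constructor
    · rintro ⟨-, h⟩
      by_contra hx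
      simp [hx] at h
    · intro hx
      exact ⟨hT x hx, by simp [hx, hr.ne']⟩
  have hnull : μ.totalVariation (Ioo a b \ jumpSet a b U) = 0 := by
    refine totalVariation_eq_zero_of_forall_Ioc (V := V) (fun x hax hxb => ?_) ?_ ?_ sdiff_subset ?_
    · rw [← Measure.toSignedMeasure_apply_measurable measurableSet_Ioc]
      linarith [h1 x hax hxb]
    · rw [← Measure.toSignedMeasure_apply_measurable measurableSet_Ioo]
      linarith
    · rw [hJ]
      exact measurableSet_Ioo.diff T.measurableSet
    · rw [hJ, pointMasses_apply _ _ (measurableSet_Ioo.diff T.measurableSet)]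
      refine Finset.sum_eq_zero fun t ht => ?_
      rw [indicator_of_notMem (fun h => h.2 ht), mul_zero]
  rw [TV, hnull, zero_add]
  have e : ∀ x : jumpSet a b U, ENNReal.ofReal ((fun ρ : ℝ => ρ / (1 + ρ))
      |rightTrace U x - leftTrace U x|) = (fun _ : ℝ => ENNReal.ofReal (r / (1 + r))) (x : ℝ) := by
    intro x
    have hx : (x : ℝ) ∈ T := Finset.mem_coe.1 (hJ.subset x.2)
    rw [jump_eq hBV.1 hU x.2.1, hsing, if_pos hx, abs_of_pos hr]
  rw [tsum_congr e, hJ, Finset.tsum_subtype' T (fun _ : ℝ => ENNReal.ofReal (r / (1 + r))),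
    Finset.sum_const, nsmul_eq_mul, ENNReal.ofReal_mul (by positivity), ENNReal.ofReal_natCast]

theorem hasBoundaryValues_stepFun (hab : a < b) (hr : 0 < r) (hT : ∀ t ∈ T, t ∈ Ioo a b)
    (hc : c = a) (hb : c + T.card * r = b) :
    HasBoundaryValues (fun x => x) a b (stepFun c r T) := by
  classical
  have hU : ∀ᵐ x ∂volume.restrict (Ioo a b),
      stepFun c r T x = c + (pointMasses r T).toSignedMeasure (Ioc a x) :=
    ae_of_all _ (stepFun_eq hr hT)
  have h1 := hasRightTrace_of_ae_eq hU le_rfl hab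
  have h2 := hasLeftTrace_of_ae_eq hU hab le_rfl
  rw [Ioc_self, VectorMeasure.empty, add_zero, hc] at h1
  have e : (pointMasses r T).real (Ioo a b) = T.card * r := by
    rw [pointMasses_real hr.le T measurableSet_Ioo, ← nsmul_eq_mul, ← Finset.sum_const]
    exact Finset.sum_congr rfl fun t ht => if_pos (hT t ht)
  rw [Measure.toSignedMeasure_apply_measurable measurableSet_Ioo, e, hb] at h2
  subst hc
  exact ⟨h1, h2⟩

end stepFun

theorem lintegral_Ioo_of_eq_const {p q c : ℝ} (hpq : p ≤ q) {u : ℝ → ℝ}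
    (hu : ∀ x ∈ Ioo p q, u x = c) :
    ∫⁻ x in Ioo p q, ENNReal.ofReal (|u x - x| ^ 2) =
      ENNReal.ofReal (((q - c) ^ 3 - (p - c) ^ 3) / 3) := by
  have h1 : ∫⁻ x in Ioo p q, ENNReal.ofReal (|u x - x| ^ 2) =
      ∫⁻ x in Ioo p q, ENNReal.ofReal ((x - c) ^ 2) := by
    refine setLIntegral_congr_fun measurableSet_Ioo fun x hx => ?_
    simp only [sq_abs, hu x hx]
    rw [← neg_sub, neg_sq]
  rw [h1, ← ofReal_integral_eq_lintegral_ofReal]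
  · rw [← integral_Ioc_eq_integral_Ioo, ← intervalIntegral.integral_of_le hpq,
      intervalIntegral.integral_comp_sub_right (fun x => x ^ 2), integral_pow]
    norm_num
  · exact ((by fun_prop : Continuous fun x : ℝ => (x - c) ^ 2).integrableOn_Icc).mono_set
      Ioo_subset_Icc_self
  · exact ae_of_all _ fun x => by positivity

theorem lintegral_Ioo_split {p t q : ℝ} (hpt : p < t) (htq : t < q) (f : ℝ → ℝ≥0∞) :
    ∫⁻ x in Ioo p q, f x = (∫⁻ x in Ioo p t, f x) + ∫⁻ x in Ioo t q, f x := by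
  rw [← Ioc_union_Ioo_eq_Ioo hpt.le htq, lintegral_union measurableSet_Ioo,
    restrict_Ioo_eq_restrict_Ioc (μ := volume) (a := p) (b := t)]
  exact Set.disjoint_left.2 fun z (h1 : z ∈ Ioc p t) (h2 : z ∈ Ioo t q) => h1.2.not_gt h2.1

theorem stepFun_singleton (c r t x : ℝ) : stepFun c r {t} x = c + if t ≤ x then r else 0 := by
  rw [stepFun, Finset.sum_singleton]

theorem stepFun_pair {c r s t : ℝ} (hst : s < t) (x : ℝ) :
    stepFun c r {s, t} x = c + ((if s ≤ x then r else 0) + if t ≤ x then r else 0) := by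
  rw [stepFun, Finset.sum_pair hst.ne]

theorem isIncreasingStep_singleton {a b c r t : ℝ} (hr : 0 < r) (ht : t ∈ Ioo a b) :
    IsIncreasingStep a b 1 (stepFun c r {t}) := by
  refine ⟨![t], ![c, c + r], Subsingleton.strictMono _, ?_, fun i => ?_, fun j x _ h1 h2 => ?_⟩
  · rw [Fin.strictMono_iff_lt_succ]
    intro i
    fin_cases i
    simpa using hr
  · fin_cases i
    exact ht
  · rw [stepFun_singleton]
    fin_cases j
    · have := h2 0 (by simp)
      simp_all
    · have := h1 0 (by simp)
      simp at this
      simp [this.le]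

theorem isIncreasingStep_pair {a b c r s t : ℝ} (hr : 0 < r) (hs : s ∈ Ioo a b) (ht : t ∈ Ioo a b)
    (hst : s < t) : IsIncreasingStep a b 2 (stepFun c r {s, t}) := by
  refine ⟨![s, t], ![c, c + r, c + (r + r)], ?_, ?_, fun i => ?_, fun j x _ h1 h2 => ?_⟩
  · rw [Fin.strictMono_iff_lt_succ]
    intro i
    fin_cases i
    simpa using hst
  · rw [Fin.strictMono_iff_lt_succ]
    intro i
    fin_cases i
    · simpa using hr
    · simpa using hr
  · fin_cases i
    · exact hs
    · exact ht
  · rw [stepFun_pair hst]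
    fin_cases j
    · have e1 : x < s := h2 0 (by decide)
      have e2 : x < t := h2 1 (by decide)
      simp [e1.not_ge, e2.not_ge]
    · have e1 : s < x := h1 0 (by decide)
      have e2 : x < t := h2 1 (by decide)
      simp [e1.le, e2.not_ge]
    · have e1 : s < x := h1 0 (by decide)
      have e2 : t < x := h1 1 (by decide)
      simp [e1.le, e2.le]

/-- The jump is at the midpoint and the uncovered height b - a - r is shared equally by the two
ends, which makes all the estimates of the lower bound sharp. For r = b - a nothing is uncovered. -/
theorem energy_singleton_le {a b lam r : ℝ} (hlam : 0 < lam) (hr : 0 < r) (hrb : r ≤ b - a) :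
    energy (fun ρ => ρ / (1 + ρ)) (fun x => x) lam a b
      (stepFun (a + (b - a - r) / 2) r {(a + b) / 2}) ≤
      ENNReal.ofReal (energyOne (b - a) lam r) := by
  obtain ⟨c, hc⟩ : ∃ c, c = a + (b - a - r) / 2 := ⟨_, rfl⟩
  obtain ⟨t, ht⟩ : ∃ t, t = (a + b) / 2 := ⟨_, rfl⟩
  rw [← hc, ← ht]
  have hab : a < b := by linarith
  have hat : a < t := by linarith
  have htb : t < b := by linarith
  have hTV := TV_stepFun_le (c := c) (T := {t}) hab hr (by simp [hat, htb])
  have e1 := lintegral_Ioo_of_eq_const (c := c) (u := stepFun c r {t}) hat.le fun x hx => by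
    rw [stepFun_singleton, if_neg hx.2.not_ge, add_zero]
  have e2 := lintegral_Ioo_of_eq_const (c := c + r) (u := stepFun c r {t}) htb.le fun x hx => by
    rw [stepFun_singleton, if_pos hx.1.le]
  have c1 : c - a = (b - a - r) / 2 := by linarith
  have c2 : b - (c + r) = (b - a - r) / 2 := by linarith
  have c3 : t - c = r / 2 := by linarith
  have c4 : t - (c + r) = -(r / 2) := by linarith
  rw [c3, ← neg_sub c a, c1] at e1
  rw [c2, c4] at e2
  have hq : 0 ≤ (b - a - r) / 2 := by linarith
  obtain ⟨q, hqe⟩ : ∃ q, q = (b - a - r) / 2 := ⟨_, rfl⟩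
  rw [← hqe] at e1 e2 hq
  rw [energy, fidelity, lintegral_Ioo_split hat htb, e1, e2, ← ENNReal.ofReal_add,
    ← ENNReal.ofReal_mul (by positivity)]
  · refine (add_le_add_left hTV _).trans ?_
    rw [← ENNReal.ofReal_add (by positivity)]
    · refine ENNReal.ofReal_le_ofReal (le_of_eq ?_)
      rw [energyOne, stepCost, show b - a - r = 2 * q by linarith]
      simp only [Finset.card_singleton, Nat.cast_one]
      ring
    · have : 0 ≤ (r / 2) ^ 3 := by positivity
      have : 0 ≤ q ^ 3 := by positivity
      have : 0 ≤ lam / 2 := by positivity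
      refine mul_nonneg this ?_
      linarith
  · have : 0 ≤ (r / 2) ^ 3 := by positivity
    have : 0 ≤ q ^ 3 := by positivity
    linarith
  · have : 0 ≤ (r / 2) ^ 3 := by positivity
    have : 0 ≤ q ^ 3 := by positivity
    linarith

theorem energy_pair_le {a b lam r : ℝ} (hlam : 0 < lam) (hr : 0 < r) (hrb : 2 * r ≤ b - a) :
    energy (fun ρ => ρ / (1 + ρ)) (fun x => x) lam a b
      (stepFun (a + (b - a - 2 * r) / 2) r {(a + b - r) / 2, (a + b + r) / 2}) ≤
      ENNReal.ofReal (energyTwo (b - a) lam r) := by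
  obtain ⟨c, hc⟩ : ∃ c, c = a + (b - a - 2 * r) / 2 := ⟨_, rfl⟩
  obtain ⟨s, hs⟩ : ∃ s, s = (a + b - r) / 2 := ⟨_, rfl⟩
  obtain ⟨t, ht⟩ : ∃ t, t = (a + b + r) / 2 := ⟨_, rfl⟩
  rw [← hc, ← hs, ← ht]
  have hab : a < b := by linarith
  have has : a < s := by linarith
  have hst : s < t := by linarith
  have htb : t < b := by linarith
  have hTV := TV_stepFun_le (c := c) (T := {s, t}) hab hr (by
    simp [has, hst.trans htb, has.trans hst, htb])
  rw [Finset.card_pair hst.ne] at hTV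
  have e1 := lintegral_Ioo_of_eq_const (c := c) (u := stepFun c r {s, t}) has.le fun x hx => by
    rw [stepFun_pair hst, if_neg hx.2.not_ge, if_neg (hx.2.trans hst).not_ge, add_zero, add_zero]
  have e2 := lintegral_Ioo_of_eq_const (c := c + r) (u := stepFun c r {s, t}) hst.le
    fun x hx => by
      rw [stepFun_pair hst, if_pos hx.1.le, if_neg hx.2.not_ge, add_zero]
  have e3 := lintegral_Ioo_of_eq_const (c := c + (r + r)) (u := stepFun c r {s, t}) htb.le
    fun x hx => by
      rw [stepFun_pair hst, if_pos (hst.trans hx.1).le, if_pos hx.1.le]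
  have c1 : c - a = (b - a - 2 * r) / 2 := by linarith
  have c2 : b - (c + (r + r)) = (b - a - 2 * r) / 2 := by linarith
  have c3 : s - c = r / 2 := by linarith
  have c4 : s - (c + r) = -(r / 2) := by linarith
  have c5 : t - (c + r) = r / 2 := by linarith
  have c6 : t - (c + (r + r)) = -(r / 2) := by linarith
  rw [c3, ← neg_sub c a, c1] at e1
  rw [c4, c5] at e2
  rw [c2, c6] at e3
  have hq : 0 ≤ (b - a - 2 * r) / 2 := by linarith
  obtain ⟨q, hqe⟩ : ∃ q, q = (b - a - 2 * r) / 2 := ⟨_, rfl⟩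
  rw [← hqe] at e1 e3 hq
  have p1 : 0 ≤ (r / 2) ^ 3 := by positivity
  have p2 : 0 ≤ q ^ 3 := by positivity
  have p3 : 0 ≤ lam / 2 := by positivity
  rw [energy, fidelity, lintegral_Ioo_split (has.trans hst) htb, lintegral_Ioo_split has hst, e1,
    e2, e3, ← ENNReal.ofReal_add (by linarith) (by linarith),
    ← ENNReal.ofReal_add (by linarith) (by linarith), ← ENNReal.ofReal_mul p3]
  refine (add_le_add_left hTV _).trans ?_
  rw [← ENNReal.ofReal_add (by positivity) (mul_nonneg p3 (by linarith))]
  refine ENNReal.ofReal_le_ofReal (le_of_eq ?_)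
  rw [energyTwo, stepCost, show b - a - 2 * r = 2 * q by linarith]
  push_cast
  ring

/-! ### Upper and lower bounds together -/

theorem exists_minimizers (a b : ℝ) (hab : a < b) : ∃ lam : ℝ, 0 < lam ∧ ∃ U₁ U₂ : ℝ → ℝ,
    IsMinimizer (fun ρ => ρ / (1 + ρ)) (fun x => x) lam a b U₁ ∧
    IsMinimizer (fun ρ => ρ / (1 + ρ)) (fun x => x) lam a b U₂ ∧
    IsIncreasingStep a b 1 U₁ ∧ IsIncreasingStep a b 2 U₂ := by
  obtain ⟨lam, hlam, r₁, r₂, h1, h1', h2, h2', htie, hmin₁, hmin₂⟩ := exists_tie (sub_pos.2 hab)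
  have hle : ∀ v : ℝ → ℝ, IsBV a b v → ENNReal.ofReal (energyOne (b - a) lam r₁) ≤
      energy (fun ρ => ρ / (1 + ρ)) (fun x => x) lam a b v := fun v hv =>
    le_energy_of_forall_sum hab hlam (fun n ρ hρ hP =>
      le_sum_stepCost_of_tie hlam hmin₁ (fun r h h' => htie ▸ hmin₂ r h h') h1.le h1' rfl
        Finset.univ ρ (fun i _ => hρ i) hP) hv
  have hs : (a + b) / 2 ∈ Ioo a b := by constructor <;> linarith
  have hs₂ : (a + b - r₂) / 2 ∈ Ioo a b := by constructor <;> linarith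
  have ht₂ : (a + b + r₂) / 2 ∈ Ioo a b := by constructor <;> linarith
  exact ⟨lam, hlam, _, _,
    ⟨isBV_stepFun hab h1 (by simpa using hs), fun v hv =>
      (energy_singleton_le hlam h1 h1').trans (hle v hv)⟩,
    ⟨isBV_stepFun hab h2 (by simpa using And.intro hs₂ ht₂), fun v hv =>
      (energy_pair_le hlam h2 h2').trans (htie ▸ hle v hv)⟩,
    isIncreasingStep_singleton h1 hs, isIncreasingStep_pair h2 hs₂ ht₂ (by linarith)⟩

theorem exists_dirichletMinimizers {a b lam : ℝ} (hab : a < b)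
    (hlam : lam = 32 / ((b - a) * (b - a + 1) * (b - a + 2))) : ∃ U₁ U₂ : ℝ → ℝ,
    IsDirichletMinimizer (fun ρ => ρ / (1 + ρ)) (fun x => x) lam a b U₁ ∧
    IsDirichletMinimizer (fun ρ => ρ / (1 + ρ)) (fun x => x) lam a b U₂ ∧
    IsIncreasingStep a b 1 U₁ ∧ IsIncreasingStep a b 2 U₂ := by
  have hL : 0 < b - a := sub_pos.2 hab
  have hlam0 : 0 < lam := by rw [hlam]; positivity
  have hle : ∀ v : ℝ → ℝ, IsBV a b v → HasBoundaryValues (fun x => x) a b v →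
      ENNReal.ofReal (stepCost lam (b - a)) ≤
        energy (fun ρ => ρ / (1 + ρ)) (fun x => x) lam a b v := fun v hv hbd =>
    le_energy_of_forall_sum_of_boundary hab hlam0 (fun n ρ hρ hP =>
      stepCost_le_sum_of_explicit hL hlam Finset.univ ρ (fun i _ => hρ i) hP) hv hbd
  have e1 : energyOne (b - a) lam (b - a) = stepCost lam (b - a) := by simp [energyOne]
  have e2 : energyTwo (b - a) lam ((b - a) / 2) = stepCost lam (b - a) := by
    rw [← stepCost_eq_of_explicit hL hlam, energyTwo, mul_div_cancel₀ _ two_ne_zero, sub_self]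
    simp
  have hr : 0 < (b - a) / 2 := by positivity
  have hs : (a + b) / 2 ∈ Ioo a b := by constructor <;> linarith
  have hs₂ : (a + b - (b - a) / 2) / 2 ∈ Ioo a b := by constructor <;> linarith
  have ht₂ : (a + b + (b - a) / 2) / 2 ∈ Ioo a b := by constructor <;> linarith
  have hT₁ : ∀ t ∈ ({(a + b) / 2} : Finset ℝ), t ∈ Ioo a b := by simpa using hs
  have hT₂ : ∀ t ∈ ({(a + b - (b - a) / 2) / 2, (a + b + (b - a) / 2) / 2} : Finset ℝ),
      t ∈ Ioo a b := by simpa using And.intro hs₂ ht₂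
  refine ⟨_, _,
    ⟨⟨isBV_stepFun hab hL hT₁, hasBoundaryValues_stepFun hab hL hT₁ ?_ ?_⟩, fun v hv hbd =>
      (energy_singleton_le hlam0 hL le_rfl).trans (e1 ▸ hle v hv hbd)⟩,
    ⟨⟨isBV_stepFun hab hr hT₂, hasBoundaryValues_stepFun hab hr hT₂ ?_ ?_⟩, fun v hv hbd =>
      (energy_pair_le hlam0 hr (by linarith)).trans (e2 ▸ hle v hv hbd)⟩,
    isIncreasingStep_singleton hL hs, isIncreasingStep_pair hr hs₂ ht₂ (by linarith)⟩
  · ring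
  · rw [Finset.card_singleton]
    push_cast
    ring
  · ring
  · rw [Finset.card_pair (by intro h; linarith)]
    push_cast
    ring

end KWC

theorem mainTheorem6 (a b : ℝ) (hab : a < b) :
    (∃ lam : ℝ, 0 < lam ∧ ∃ U₁ U₂ : ℝ → ℝ,
      KWC.IsMinimizer (fun ρ => ρ / (1 + ρ)) (fun x => x) lam a b U₁ ∧
      KWC.IsMinimizer (fun ρ => ρ / (1 + ρ)) (fun x => x) lam a b U₂ ∧
      KWC.IsIncreasingStep a b 1 U₁ ∧ KWC.IsIncreasingStep a b 2 U₂) ∧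
    ∀ L : ℝ, L = b - a → ∀ lam : ℝ, lam = 32 / (L * (L + 1) * (L + 2)) →
      ∃ U₁ U₂ : ℝ → ℝ,
        KWC.IsDirichletMinimizer (fun ρ => ρ / (1 + ρ)) (fun x => x) lam a b U₁ ∧
        KWC.IsDirichletMinimizer (fun ρ => ρ / (1 + ρ)) (fun x => x) lam a b U₂ ∧
        KWC.IsIncreasingStep a b 1 U₁ ∧ KWC.IsIncreasingStep a b 2 U₂ := by
  refine ⟨KWC.exists_minimizers a b hab, ?_⟩
  rintro L rfl lam hlam
  exact KWC.exists_dirichletMinimizers hab hlam
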